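/- Let $G$ be a finite group. A Mackey, semi-Mackey or (semi-)Tambara functor on $G$ is taken in the set-valued sense of Nakaoka: a semi-Mackey functor $M$ on $G$ consists of a contravariant functor $M^{*}$ (restrictions) and a covariant functor $M_{*}$ (transfers) on finite $G$-sets with the same values $M(X)$, such that $M^{*}$ sends finite coproducts to products and the Mackey (base change) condition holds for pull-back squares; each $M(X)$ is then a commutative monoid, and $M$ is a Mackey functor if all $M(X)$ are groups. A Tambara functor $T$ has restrictions $f^{*}$, additive transfers $f_{+}$ and multiplicative transfers $f_{\bullet}$ such that $T^{\alpha}=(T^{*},T_{+})$ is a Mackey functor, $T^{\mu}=(T^{*},T_{\bullet})$ is a semi-Mackey functor, and the distributive law holds for all exponential diagrams; each $T(X)$ is then a commutative ring. Let $\Omega$ be the Burnside ring functor, the initial Tambara functor on $G$. For Tambara functors $T,S$ let $T\otimes_\Omega S$ be their tensor product, i.e. $$(T\otimes_\Omega S)(X)=\Big(\bigoplus_{p:A\to X}T(A)\otimes_{\mathbb Z}S(A)\Big)\Big/\mathcal I ,$$ where $\mathcal I$ is generated by the elements $a^{*}(s')\otimes t-s'\otimes a_{+}(t)$ and $a_{+}(s)\otimes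 t'-s\otimes a^{*}(t')$ for maps $a$ of finite $G$-sets over $X$; it is a Tambara functor and the coproduct of $T$ and $S$. The class of $s\otimes t$ in the component $p:A\to X$ is denoted by $[s\otimes t]_{(A,p)}$. A Hopf Tambara functor is a Tambara functor $H$ with morphisms of Tambara functors $\Delta:H\to H\otimes_\Omega H$, $\varepsilon:H\to\Omega$ and $\eta:H\to H$ such that, up to the canonical associativity and unit isomorphisms, $$(\Delta\otimes\mathrm{id})\circ\Delta=(\mathrm{id}\otimes\Delta)\circ\Delta,\qquad (\varepsilon\otimes\mathrm{id})\circ\Delta=\mathrm{id}=(\mathrm{id}\otimes\varepsilon)\circ\Delta,$$ $$\nabla\circ(\eta\otimes\mathrm{id})\circ\Delta=\iota\circ\varepsilon=\nabla\circ(\mathrm{id}\otimes\eta)\circ\Delta,$$ where $\nabla:H\otimes_\Omega H\to H$ is the multiplication (codiagonal) and $\iota:\Omega\to H$ is the unique morphism. An element $m\in H(X)$ is group-like if $\Delta_X(m)=[m\otimes m]_{(X,\mathrm{id}_X)}$ in $(H\otimes_\Omega H)(X)$ and $\varepsilon_X(m)=1$ in $\Omega(X)$. **Proposition.** Let $H$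 be a Hopf Tambara functor on $G$, and for each finite $G$-set $X$ let $$M_H(X)=\{m\in H(X)\mid m\text{ is group-like}\}.$$ Then each $M_H(X)$ is a subgroup of the multiplicative monoid $H^{\mu}(X)$ (a submonoid in which every element has an inverse), and $M_H$ is a Mackey subfunctor of $H^{\mu}$: for every map $f:X\to Y$ of finite $G$-sets, the restriction $f^{*}$ maps $M_H(Y)$ into $M_H(X)$ and the multiplicative transfer $f_{\bullet}$ maps $M_H(X)$ into $M_H(Y)$, and with these maps $M_H$ is a Mackey functor. -/

import Mathlib

universe u v w w' w''

/-- A finite `G`-set. Equivariant maps are Mathlib's `X →[G] Y`. -/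
structure FinGSet (G : Type u) [Group G] where
  carrier : Type u
  [finite : Finite carrier]
  [action : MulAction G carrier]

namespace FinGSet

section

variable {G : Type u} [Group G]

instance : CoeSort (FinGSet G) (Type u) := ⟨FinGSet.carrier⟩

attribute [instance] FinGSet.finite FinGSet.action

/-- An equivariant map from a function and its equivariance. -/
def mkHom {X Y : FinGSet G} (f : X → Y) (h : ∀ (g : G) (x : X), f (g • x) = g • f x) : X →[G] Y :=
  ⟨f, h⟩

@[simp] theorem mkHom_apply {X Y : FinGSet G} (f : X → Y)
    (h : ∀ (g : G) (x : X), f (g • x) = g • f x) (x : X) : mkHom f h x = f x := rfl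

theorem map_act {X Y : FinGSet G} (f : X →[G] Y) (g : G) (x : X) : f (g • x) = g • f x :=
  f.map_smul' g x

theorem homExt {X Y : FinGSet G} {f f' : X →[G] Y} (h : ∀ x, f x = f' x) : f = f' :=
  MulActionHom.ext h

/-- The identity map. -/
def idHom (X : FinGSet G) : X →[G] X := mkHom (fun x => x) (fun _ _ => rfl)

@[simp] theorem idHom_apply (X : FinGSet G) (x : X) : idHom X x = x := rfl

/-- The composite `g ∘ f`. -/
def comp {X Y Z : FinGSet G} (g : Y →[G] Z) (f : X →[G] Y) : X →[G] Z :=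
  mkHom (fun x => g (f x)) (fun a x => by simp only [map_act])

@[simp] theorem comp_apply {X Y Z : FinGSet G} (g : Y →[G] Z) (f : X →[G] Y) (x : X) :
    comp g f x = g (f x) := rfl

/-- The empty `G`-set. -/
def empty (G : Type u) [Group G] : FinGSet G :=
  letI : MulAction G PEmpty.{u+1} :=
    { smul := fun _ x => x, one_smul := fun _ => rfl, mul_smul := fun _ _ _ => rfl }
  ⟨PEmpty.{u+1}⟩

instance : IsEmpty (empty G) := inferInstanceAs (IsEmpty PEmpty)

/-- The map out of an empty `G`-set. -/
def elim (E X : FinGSet G) [IsEmpty E] : E →[G] X :=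
  mkHom (fun e => isEmptyElim e) (fun _ e => isEmptyElim e)

/-- The coproduct (disjoint union) of two finite `G`-sets. -/
def sum (X Y : FinGSet G) : FinGSet G := ⟨X ⊕ Y⟩

def inl (X Y : FinGSet G) : X →[G] sum X Y := mkHom (fun x => Sum.inl x) (fun _ _ => rfl)

def inr (X Y : FinGSet G) : Y →[G] sum X Y := mkHom (fun x => Sum.inr x) (fun _ _ => rfl)

/-- The map out of a coproduct with given components. -/
def copair {X Y Z : FinGSet G} (f : X →[G] Z) (g : Y →[G] Z) : sum X Y →[G] Z :=
  mkHom (Sum.elim f g) (fun a x => by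
    cases x with
    | inl x => exact map_act f a x
    | inr y => exact map_act g a y)

@[simp] theorem copair_inl {X Y Z : FinGSet G} (f : X →[G] Z) (g : Y →[G] Z) (x : X) :
    copair f g (inl X Y x) = f x := rfl

@[simp] theorem copair_inr {X Y Z : FinGSet G} (f : X →[G] Z) (g : Y →[G] Z) (y : Y) :
    copair f g (inr X Y y) = g y := rfl

theorem sum_cases {X Y : FinGSet G} (c : sum X Y) :
    (∃ x, c = inl X Y x) ∨ (∃ y, c = inr X Y y) := by
  rcases c with x | y
  · exact Or.inl ⟨x, rfl⟩
  · exact Or.inr ⟨y, rfl⟩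

theorem inl_injective {X Y : FinGSet G} : Function.Injective (inl X Y) := fun _ _ h => Sum.inl.inj h

theorem inr_injective {X Y : FinGSet G} : Function.Injective (inr X Y) := fun _ _ h => Sum.inr.inj h

theorem inl_ne_inr {X Y : FinGSet G} (x : X) (y : Y) : inl X Y x ≠ inr X Y y := fun h => by cases h

theorem inr_ne_inl {X Y : FinGSet G} (x : X) (y : Y) : inr X Y y ≠ inl X Y x := fun h => by cases h

/-- The coproduct of two equivariant maps. -/
def sumMap {X Y X' Y' : FinGSet G} (f : X →[G] X') (g : Y →[G] Y') : sum X Y →[G] sum X' Y' :=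
  copair (comp (inl X' Y') f) (comp (inr X' Y') g)

@[simp] theorem sumMap_inl {X Y X' Y' : FinGSet G} (f : X →[G] X') (g : Y →[G] Y') (x : X) :
    sumMap f g (inl X Y x) = inl X' Y' (f x) := rfl

@[simp] theorem sumMap_inr {X Y X' Y' : FinGSet G} (f : X →[G] X') (g : Y →[G] Y') (y : Y) :
    sumMap f g (inr X Y y) = inr X' Y' (g y) := rfl

/-- The folding map `X ⊔ X → X`. -/
def fold (X : FinGSet G) : sum X X →[G] X := copair (idHom X) (idHom X)

@[simp] theorem fold_inl {X : FinGSet G} (x : X) : fold X (inl X X x) = x := rfl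

@[simp] theorem fold_inr {X : FinGSet G} (x : X) : fold X (inr X X x) = x := rfl

/-- The square
```
P --a--> A
|x       |p
X --f--> Y
```
is a pull-back diagram. -/
structure IsPB {P A X Y : FinGSet G} (a : P →[G] A) (x : P →[G] X) (p : A →[G] Y) (f : X →[G] Y) :
    Prop where
  comm : ∀ z, p (a z) = f (x z)
  existsUnique : ∀ a₀ x₀, p a₀ = f x₀ → ∃! z, a z = a₀ ∧ x z = x₀

/-- The canonical fibre product `A ×_Y X`. -/
def pb {A X Y : FinGSet G} (p : A →[G] Y) (f : X →[G] Y) : FinGSet G :=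
  letI : MulAction G {z : A × X // p z.1 = f z.2} :=
    { smul := fun g z => ⟨(g • z.1.1, g • z.1.2), by simp only [map_act, z.2]⟩
      one_smul := fun z => Subtype.ext (Prod.ext (one_smul G z.1.1) (one_smul G z.1.2))
      mul_smul := fun g h z =>
        Subtype.ext (Prod.ext (mul_smul g h z.1.1) (mul_smul g h z.1.2)) }
  ⟨{z : A × X // p z.1 = f z.2}⟩

section

variable {A X Y : FinGSet G} (p : A →[G] Y) (f : X →[G] Y)

def pbFst : pb p f →[G] A := mkHom (fun z => z.1.1) (fun _ _ => rfl)

def pbSnd : pb p f →[G] X := mkHom (fun z => z.1.2) (fun _ _ => rfl)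

variable {p f} in
def pbMk (a : A) (x : X) (h : p a = f x) : pb p f := ⟨(a, x), h⟩

@[simp] theorem pbFst_mk (a : A) (x : X) (h : p a = f x) : pbFst p f (pbMk a x h) = a := rfl

@[simp] theorem pbSnd_mk (a : A) (x : X) (h : p a = f x) : pbSnd p f (pbMk a x h) = x := rfl

theorem pb_comm (z : pb p f) : p (pbFst p f z) = f (pbSnd p f z) := z.2

variable {p f} in
theorem pbExt {z z' : pb p f} (h₁ : pbFst p f z = pbFst p f z') (h₂ : pbSnd p f z = pbSnd p f z') :
    z = z' := Subtype.ext (Prod.ext h₁ h₂)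

theorem isPB_pb : IsPB (pbFst p f) (pbSnd p f) p f :=
  ⟨pb_comm p f, fun a x h => ⟨pbMk a x h, ⟨rfl, rfl⟩, fun _ hz => pbExt hz.1 hz.2⟩⟩

end

theorem IsPB.ext {P A X Y : FinGSet G} {a : P →[G] A} {x : P →[G] X} {p : A →[G] Y} {f : X →[G] Y}
    (h : IsPB a x p f) {z z' : P} (h₁ : a z = a z') (h₂ : x z = x z') : z = z' :=
  (h.existsUnique _ _ (h.comm z')).unique ⟨h₁, h₂⟩ ⟨rfl, rfl⟩

theorem IsPB.exists {P A X Y : FinGSet G} {a : P →[G] A} {x : P →[G] X} {p : A →[G] Y}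
    {f : X →[G] Y} (h : IsPB a x p f) {a₀ : A} {x₀ : X} (e : p a₀ = f x₀) :
    ∃ z, a z = a₀ ∧ x z = x₀ := (h.existsUnique _ _ e).exists

theorem IsPB.mk' {P A X Y : FinGSet G} {a : P →[G] A} {x : P →[G] X} {p : A →[G] Y} {f : X →[G] Y}
    (comm : ∀ z, p (a z) = f (x z)) (ex : ∀ a₀ x₀, p a₀ = f x₀ → ∃ z, a z = a₀ ∧ x z = x₀)
    (un : ∀ z z', a z = a z' → x z = x z' → z = z') : IsPB a x p f :=
  ⟨comm, fun a₀ x₀ h => by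
    obtain ⟨z, h₁, h₂⟩ := ex a₀ x₀ h
    exact ⟨z, ⟨h₁, h₂⟩, fun z' h' => un _ _ (h'.1.trans h₁.symm) (h'.2.trans h₂.symm)⟩⟩

theorem IsPB.flip {P A X Y : FinGSet G} {a : P →[G] A} {x : P →[G] X} {p : A →[G] Y}
    {f : X →[G] Y} (h : IsPB a x p f) : IsPB x a f p :=
  .mk' (fun z => (h.comm z).symm) (fun a₀ x₀ e => by
    obtain ⟨z, h₁, h₂⟩ := h.exists e.symm; exact ⟨z, h₂, h₁⟩) (fun _ _ h₁ h₂ => h.ext h₂ h₁)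

/-- The canonical comparison map between two pull-backs of the same maps. -/
noncomputable def IsPB.lift {P A X Y Q : FinGSet G} {a : P →[G] A} {x : P →[G] X} {p : A →[G] Y}
    {f : X →[G] Y} (h : IsPB a x p f) (b : Q →[G] A) (y : Q →[G] X) (e : ∀ z, p (b z) = f (y z)) :
    Q →[G] P :=
  mkHom (fun z => (h.exists (e z)).choose) (fun g z => by
    apply h.ext
    · rw [(h.exists (e (g • z))).choose_spec.1, map_act, map_act, (h.exists (e z)).choose_spec.1]
    · rw [(h.exists (e (g • z))).choose_spec.2, map_act, map_act, (h.exists (e z)).choose_spec.2])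

theorem IsPB.lift_fst {P A X Y Q : FinGSet G} {a : P →[G] A} {x : P →[G] X} {p : A →[G] Y}
    {f : X →[G] Y} (h : IsPB a x p f) (b : Q →[G] A) (y : Q →[G] X) (e : ∀ z, p (b z) = f (y z))
    (z : Q) : a (h.lift b y e z) = b z := (h.exists (e z)).choose_spec.1

theorem IsPB.lift_snd {P A X Y Q : FinGSet G} {a : P →[G] A} {x : P →[G] X} {p : A →[G] Y}
    {f : X →[G] Y} (h : IsPB a x p f) (b : Q →[G] A) (y : Q →[G] X) (e : ∀ z, p (b z) = f (y z))
    (z : Q) : x (h.lift b y e z) = y z := (h.exists (e z)).choose_spec.2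

/-! ### Exponential diagrams -/

/-- The underlying set of `Π_f(A)`, for `f : X → Y` and `p : A → X`: pairs of a point `y` of `Y` and
a set-theoretic section `σ : f⁻¹(y) → A` of `p` over `f⁻¹(y)`. -/
structure Sections {X Y A : FinGSet G} (f : X →[G] Y) (p : A →[G] X) where
  pt : Y
  sec : {x : X // f x = pt} → A
  sec_spec : ∀ x, p (sec x) = x.1

section

variable {X Y A : FinGSet G} {f : X →[G] Y} {p : A →[G] X}

theorem Sections.ext' {s t : Sections f p} (h : s.pt = t.pt)
    (h' : ∀ x hs ht, s.sec ⟨x, hs⟩ = t.sec ⟨x, ht⟩) : s = t := by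
  obtain ⟨y, σ, hσ⟩ := s
  obtain ⟨y', τ, hτ⟩ := t
  obtain rfl : y = y' := h
  obtain rfl : σ = τ := funext fun x => h' x.1 x.2 x.2
  rfl

instance : Finite (Sections f p) := by
  refine Finite.of_injective (β := Y × Set (X × A))
    (fun s => (s.pt, {z | ∃ h, s.sec ⟨z.1, h⟩ = z.2})) (fun s t h => ?_)
  have h₁ : s.pt = t.pt := congrArg Prod.fst h
  have h₂ := congrArg Prod.snd h
  refine Sections.ext' h₁ (fun x hs ht => ?_)
  have : (x, s.sec ⟨x, hs⟩) ∈ {z : X × A | ∃ h, t.sec ⟨z.1, h⟩ = z.2} := by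
    exact h₂.subset (show (x, s.sec ⟨x, hs⟩) ∈ {z : X × A | ∃ h, s.sec ⟨z.1, h⟩ = z.2} from ⟨hs, rfl⟩)
  exact this.2.symm

instance : SMul G (Sections f p) where
  smul g s :=
    { pt := g • s.pt
      sec := fun x => g • s.sec ⟨g⁻¹ • x.1, by rw [map_act, x.2, inv_smul_smul]⟩
      sec_spec := fun x => by rw [map_act, s.sec_spec, smul_inv_smul] }

theorem Sections.smul_pt (g : G) (s : Sections f p) : (g • s).pt = g • s.pt := rfl

theorem Sections.sec_congr (s : Sections f p) {x x' : X} (h : f x = s.pt) (e : x = x') :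
    s.sec ⟨x, h⟩ = s.sec ⟨x', e ▸ h⟩ := by subst e; rfl

theorem Sections.smul_sec (g : G) (s : Sections f p) (x : X) (h : f x = (g • s).pt)
    (h' : f (g⁻¹ • x) = s.pt) : (g • s).sec ⟨x, h⟩ = g • s.sec ⟨g⁻¹ • x, h'⟩ := rfl

theorem Sections.smul_sec' (g : G) (s : Sections f p) (x : X) (h : f (g • x) = (g • s).pt)
    (h' : f x = s.pt) : (g • s).sec ⟨g • x, h⟩ = g • s.sec ⟨x, h'⟩ := by
  rw [Sections.smul_sec g s _ h (by rw [inv_smul_smul]; exact h')]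
  exact congrArg (g • ·) (s.sec_congr _ (inv_smul_smul g x))

instance : MulAction G (Sections f p) where
  one_smul s := Sections.ext' (one_smul G s.pt) (fun x hs ht => by
    rw [Sections.smul_sec 1 s x hs (by rw [inv_one, one_smul]; exact ht), one_smul]
    exact s.sec_congr _ (by simp))
  mul_smul g h s := Sections.ext' (mul_smul g h s.pt) (fun x hs ht => by
    have e : f ((g * h)⁻¹ • x) = s.pt := by rw [map_act, hs, Sections.smul_pt, inv_smul_smul]
    have e' : f (g⁻¹ • x) = (h • s).pt := by rw [map_act, ht, Sections.smul_pt, inv_smul_smul]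
    have e'' : f (h⁻¹ • g⁻¹ • x) = s.pt := by rw [map_act, e', Sections.smul_pt, inv_smul_smul]
    rw [Sections.smul_sec _ _ _ hs e, Sections.smul_sec _ _ _ ht e', Sections.smul_sec _ _ _ e' e'',
      mul_smul]
    exact congrArg (fun z => g • h • z) (s.sec_congr _ (by simp [mul_smul])))

end

/-- The finite `G`-set `Π_f(A)`, with the action `(g • σ)(x) = g • σ(g⁻¹ • x)`. -/
def Pi {X Y A : FinGSet G} (f : X →[G] Y) (p : A →[G] X) : FinGSet G := ⟨Sections f p⟩

section

variable {X Y A : FinGSet G} (f : X →[G] Y) (p : A →[G] X)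

/-- `π : Π_f(A) → Y`, `(y, σ) ↦ y`. -/
def piProj : Pi f p →[G] Y := mkHom (fun s : Sections f p => s.pt) (fun _ _ => rfl)

/-- `X ×_Y Π_f(A)`. -/
abbrev PiTot : FinGSet G := pb f (piProj f p)

/-- The projection `f' : X ×_Y Π_f(A) → Π_f(A)`, the pull-back of `f` along `π`. -/
def piMap : PiTot f p →[G] Pi f p := pbSnd f (piProj f p)

/-- The evaluation `e : X ×_Y Π_f(A) → A`, `(x, (y, σ)) ↦ σ(x)`. -/
def piEval : PiTot f p →[G] A :=
  mkHom (fun z => Sections.sec (pbSnd f (piProj f p) z) ⟨pbFst f (piProj f p) z, z.2⟩)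
    (fun g _ => Sections.smul_sec' g _ _ _ _)

theorem piEval_spec (z : PiTot f p) : p (piEval f p z) = pbFst f (piProj f p) z :=
  Sections.sec_spec _ _

end

/-- The diagram
```
X <--p-- A <--l-- Z
|f                |r
Y <------q------- B
```
is an exponential diagram: it is isomorphic, over `f` and `p`, to the canonical one. -/
def IsExponential {X Y A Z B : FinGSet G} (f : X →[G] Y) (p : A →[G] X) (l : Z →[G] A)
    (r : Z →[G] B) (q : B →[G] Y) : Prop :=
  ∃ (b : B →[G] Pi f p) (z : Z →[G] PiTot f p),
    Function.Bijective b ∧ Function.Bijective z ∧ (∀ t, piProj f p (b t) = q t) ∧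
      (∀ t, piEval f p (z t) = l t) ∧ ∀ t, piMap f p (z t) = b (r t)

/-- An elementwise criterion for exponential diagrams: `Z` is the fibre product of `X` and `B`, and
points of `B` over `y` correspond to sections of `p` over `f⁻¹(y)`. -/
structure IsExp {X Y A Z B : FinGSet G} (f : X →[G] Y) (p : A →[G] X) (l : Z →[G] A)
    (r : Z →[G] B) (q : B →[G] Y) : Prop where
  isPB : IsPB r (comp p l) q f
  ex : ∀ s : Sections f p, ∃ b, q b = s.pt ∧ ∀ z (h : f (p (l z)) = s.pt), r z = b → l z = s.sec ⟨p (l z), h⟩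
  un : ∀ b b', q b = q b' → (∀ z z', r z = b → r z' = b' → p (l z) = p (l z') → l z = l z') → b = b'

theorem isExp_canonical {X Y A : FinGSet G} (f : X →[G] Y) (p : A →[G] X) :
    IsExp f p (piEval f p) (piMap f p) (piProj f p) where
  isPB := .mk' (fun z => by
      rw [comp_apply, piEval_spec]; exact (pb_comm f (piProj f p) z).symm)
    (fun b x h => ⟨pbMk x b h.symm, rfl, piEval_spec f p _⟩)
    (fun z z' h₁ h₂ => by
      rw [comp_apply, comp_apply, piEval_spec, piEval_spec] at h₂
      exact pbExt h₂ h₁)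
  ex s := ⟨s, rfl, fun z h e => by
    subst e
    exact Sections.sec_congr (pbSnd f (piProj f p) z) _ (piEval_spec f p z).symm⟩
  un b b' h h' := Sections.ext' h (fun x hs ht =>
    h' (pbMk (p := f) (f := piProj f p) x b hs) (pbMk (p := f) (f := piProj f p) x b' ht) rfl rfl
      (Eq.trans (b := x) (piEval_spec f p _)
        (Eq.symm (piEval_spec f p (pbMk (p := f) (f := piProj f p) x b' ht)))))

section

variable {X Y A Z B : FinGSet G} {f : X →[G] Y} {p : A →[G] X} {l : Z →[G] A} {r : Z →[G] B}
  {q : B →[G] Y}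

/-- The section determined by a point of `B`. -/
noncomputable def IsExp.toSections (h : IsExp f p l r q) (b : B) : Sections f p where
  pt := q b
  sec := fun x => l (h.isPB.exists (a₀ := b) (x₀ := x.1) x.2.symm).choose
  sec_spec := fun x => (h.isPB.exists (a₀ := b) (x₀ := x.1) x.2.symm).choose_spec.2

theorem IsExp.toSections_sec (h : IsExp f p l r q) (b : B) (z : Z) (hz : r z = b) (x : X)
    (hx : f x = q b) (e : p (l z) = x) : (h.toSections b).sec ⟨x, hx⟩ = l z := by
  have h' := (h.isPB.exists (a₀ := b) (x₀ := x) hx.symm).choose_spec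
  exact congrArg l (h.isPB.ext (h'.1.trans hz.symm) (h'.2.trans e.symm))

/-- The comparison map of an exponential diagram with the canonical one. -/
noncomputable def IsExp.toPi (h : IsExp f p l r q) : B →[G] Pi f p :=
  mkHom (Y := Pi f p) h.toSections (fun g b => Sections.ext' (map_act q g b) (fun x hs ht => by
    have e : f (g⁻¹ • x) = q b := by
      rw [map_act, hs]; exact (congrArg (g⁻¹ • ·) (map_act q g b)).trans (inv_smul_smul g _)
    obtain ⟨z, hz, hx⟩ := h.isPB.exists (a₀ := b) (x₀ := g⁻¹ • x) e.symm
    rw [h.toSections_sec (g • b) (g • z) (by rw [map_act, hz]) x hs (by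
      rw [map_act, map_act, show p (l z) = _ from hx, smul_inv_smul])]
    refine Eq.trans ?_ (Sections.smul_sec g (h.toSections b) x ht e).symm
    rw [h.toSections_sec b z hz (g⁻¹ • x) e hx, map_act]))

theorem IsExp.toPi_bijective (h : IsExp f p l r q) : Function.Bijective h.toPi := by
  constructor
  · intro b b' e
    refine h.un b b' (congrArg Sections.pt e) (fun z z' hz hz' hzz => ?_)
    have hb : f (p (l z)) = q b := by rw [← hz]; exact (h.isPB.comm z).symm
    have hb' : f (p (l z)) = q b' := by rw [hzz, ← hz']; exact (h.isPB.comm z').symm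
    rw [← h.toSections_sec b z hz _ hb rfl, ← h.toSections_sec b' z' hz' _ hb' hzz.symm]
    have : ∀ s t : Sections f p, s = t → ∀ x hs ht, s.sec ⟨x, hs⟩ = t.sec ⟨x, ht⟩ := by
      rintro s t rfl x hs ht; rfl
    exact this _ _ e _ _ _
  · intro s
    obtain ⟨b, hb, hb'⟩ := h.ex s
    refine ⟨b, Sections.ext' hb (fun x hs ht => ?_)⟩
    obtain ⟨z, hz, hx⟩ := h.isPB.exists (a₀ := b) (x₀ := x) hs.symm
    refine (h.toSections_sec b z hz x hs hx).trans ?_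
    have hx' : p (l z) = x := hx
    rw [hb' z (by rw [hx']; exact ht) hz]
    exact Sections.sec_congr s _ hx'

theorem IsExp.isExponential (h : IsExp f p l r q) : IsExponential f p l r q := by
  have hpb := isPB_pb f (piProj f p)
  have e : ∀ z, f (comp p l z) = piProj f p (comp h.toPi r z) := fun t => (h.isPB.comm t).symm
  let zz : Z →[G] PiTot f p := hpb.lift (comp p l) (comp h.toPi r) e
  have h₁ : ∀ t, pbFst f (piProj f p) (zz t) = p (l t) := hpb.lift_fst _ _ e
  have h₂ : ∀ t, pbSnd f (piProj f p) (zz t) = h.toPi (r t) := hpb.lift_snd _ _ e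
  refine ⟨h.toPi, zz, h.toPi_bijective, ⟨fun t t' ht => ?_, fun t => ?_⟩, fun t => rfl,
    fun t => ?_, h₂⟩
  · refine h.isPB.ext (h.toPi_bijective.1 ?_) ?_
    · rw [← h₂, ← h₂, ht]
    · exact (h₁ t).symm.trans ((congrArg _ ht).trans (h₁ t'))
  · obtain ⟨b, hb⟩ := h.toPi_bijective.2 (pbSnd f (piProj f p) t)
    have : q b = f (pbFst f (piProj f p) t) := by
      rw [pb_comm, ← hb]; rfl
    obtain ⟨z, hz, hx⟩ := h.isPB.exists this
    exact ⟨z, pbExt ((h₁ z).trans hx) ((h₂ z).trans (by rw [hz, hb]))⟩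
  · have : ∀ s : Sections f p, s = h.toPi (r t) → ∀ x hs, p (l t) = x → s.sec ⟨x, hs⟩ = l t := by
      rintro s rfl x hs hx
      exact h.toSections_sec (r t) t rfl x hs hx
    exact this _ (h₂ t) _ _ (h₁ t).symm

end

end

end FinGSet

/-! ## Semi-Mackey functors -/

section

variable {G : Type u} [Group G]

open FinGSet

/-- The contravariant functor with values `obj` and restrictions `res`, and the covariant functor
with values `obj` and transfers `tr`, form a semi-Mackey functor: `res` sends finite coproducts to
products, and the Mackey condition holds. -/
structure IsSemiMackey (obj : FinGSet G → Type w)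
    (res : ∀ {X Y : FinGSet G}, (X →[G] Y) → obj Y → obj X)
    (tr : ∀ {X Y : FinGSet G}, (X →[G] Y) → obj X → obj Y) : Prop where
  res_id : ∀ {X : FinGSet G} (a : obj X), res (idHom X) a = a
  res_comp : ∀ {X Y Z : FinGSet G} (f : X →[G] Y) (g : Y →[G] Z) (a : obj Z),
    res (comp g f) a = res f (res g a)
  tr_id : ∀ {X : FinGSet G} (a : obj X), tr (idHom X) a = a
  tr_comp : ∀ {X Y Z : FinGSet G} (f : X →[G] Y) (g : Y →[G] Z) (a : obj X),
    tr (comp g f) a = tr g (tr f a)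
  bijective_sum : ∀ X Y : FinGSet G,
    Function.Bijective fun c : obj (sum X Y) => (res (inl X Y) c, res (inr X Y) c)
  existsUnique_empty : ∀ X : FinGSet G, IsEmpty X → ∃! _ : obj X, True
  mackey : ∀ {X' Y' X Y : FinGSet G} (f' : X' →[G] Y') (x : X' →[G] X) (y : Y' →[G] Y)
    (f : X →[G] Y), IsPB f' x y f → ∀ c : obj Y', tr x (res f' c) = res f (tr y c)

/-- A semi-Mackey functor on `G`. -/
structure SemiMackey (G : Type u) [Group G] where
  obj : FinGSet G → Type w
  res : ∀ {X Y : FinGSet G}, (X →[G] Y) → obj Y → obj X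
  tr : ∀ {X Y : FinGSet G}, (X →[G] Y) → obj X → obj Y
  isSemiMackey : IsSemiMackey obj res tr

namespace SemiMackey

variable (M : SemiMackey.{u, w} G)

section

variable {M}

theorem res_id {X : FinGSet G} (a : M.obj X) : M.res (idHom X) a = a := M.isSemiMackey.res_id a

theorem res_comp {X Y Z : FinGSet G} (f : X →[G] Y) (g : Y →[G] Z) (a : M.obj Z) :
    M.res (comp g f) a = M.res f (M.res g a) := M.isSemiMackey.res_comp f g a

theorem tr_id {X : FinGSet G} (a : M.obj X) : M.tr (idHom X) a = a := M.isSemiMackey.tr_id a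

theorem tr_comp {X Y Z : FinGSet G} (f : X →[G] Y) (g : Y →[G] Z) (a : M.obj X) :
    M.tr (comp g f) a = M.tr g (M.tr f a) := M.isSemiMackey.tr_comp f g a

theorem mackey {X' Y' X Y : FinGSet G} {f' : X' →[G] Y'} {x : X' →[G] X} {y : Y' →[G] Y}
    {f : X →[G] Y} (h : IsPB f' x y f) (c : M.obj Y') : M.tr x (M.res f' c) = M.res f (M.tr y c) :=
  M.isSemiMackey.mackey f' x y f h c

theorem res_res {X Y Z : FinGSet G} {f : X →[G] Y} {g : Y →[G] Z} {h : X →[G] Z}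
    (e : ∀ x, h x = g (f x)) (a : M.obj Z) : M.res f (M.res g a) = M.res h a := by
  rw [← res_comp]; congr 1; exact homExt fun x => (e x).symm

theorem tr_tr {X Y Z : FinGSet G} {f : X →[G] Y} {g : Y →[G] Z} {h : X →[G] Z}
    (e : ∀ x, h x = g (f x)) (a : M.obj X) : M.tr g (M.tr f a) = M.tr h a := by
  rw [← tr_comp]; congr 1; exact homExt fun x => (e x).symm

theorem tr_res_of_bijective {X Y : FinGSet G} {f : X →[G] Y} (hf : Function.Bijective f)
    (a : M.obj Y) : M.tr f (M.res f a) = a := by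
  have : IsPB f f (idHom Y) (idHom Y) := .mk' (fun _ => rfl)
    (fun y y' h => by
      obtain ⟨x, hx⟩ := hf.2 y
      exact ⟨x, hx, hx.trans h⟩) (fun _ _ h _ => hf.1 h)
  rw [mackey this, tr_id, res_id]

theorem res_tr_of_injective {X Y : FinGSet G} {f : X →[G] Y} (hf : Function.Injective f)
    (a : M.obj X) : M.res f (M.tr f a) = a := by
  have : IsPB (idHom X) (idHom X) f f := .mk' (fun _ => rfl)
    (fun y y' h => ⟨y, rfl, hf h⟩) (fun _ _ h _ => h)
  rw [← mackey this, tr_id, res_id]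

theorem sum_ext {X Y : FinGSet G} {a b : M.obj (sum X Y)}
    (hl : M.res (inl X Y) a = M.res (inl X Y) b) (hr : M.res (inr X Y) a = M.res (inr X Y) b) :
    a = b := (M.isSemiMackey.bijective_sum X Y).1 (Prod.ext hl hr)

theorem empty_ext {X : FinGSet G} (h : IsEmpty X) (a b : M.obj X) : a = b :=
  (M.isSemiMackey.existsUnique_empty X h).unique trivial trivial

/-- The element of `M(X ⊔ Y)` with given components in `M(X)` and `M(Y)`. -/
noncomputable def pair {X Y : FinGSet G} (a : M.obj X) (b : M.obj Y) : M.obj (sum X Y) :=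
  ((M.isSemiMackey.bijective_sum X Y).2 (a, b)).choose

@[simp] theorem res_inl_pair {X Y : FinGSet G} (a : M.obj X) (b : M.obj Y) :
    M.res (inl X Y) (pair a b) = a :=
  congrArg Prod.fst ((M.isSemiMackey.bijective_sum X Y).2 (a, b)).choose_spec

@[simp] theorem res_inr_pair {X Y : FinGSet G} (a : M.obj X) (b : M.obj Y) :
    M.res (inr X Y) (pair a b) = b :=
  congrArg Prod.snd ((M.isSemiMackey.bijective_sum X Y).2 (a, b)).choose_spec

theorem pair_res {X Y : FinGSet G} (c : M.obj (sum X Y)) :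
    pair (M.res (inl X Y) c) (M.res (inr X Y) c) = c := sum_ext (by simp) (by simp)

theorem res_copair {X Y Z : FinGSet G} (f : X →[G] Z) (g : Y →[G] Z) (c : M.obj Z) :
    M.res (copair f g) c = pair (M.res f c) (M.res g c) :=
  sum_ext (by rw [res_inl_pair, res_res (h := f) (fun _ => rfl)])
    (by rw [res_inr_pair, res_res (h := g) (fun _ => rfl)])

theorem res_sumMap {X Y X' Y' : FinGSet G} (f : X →[G] X') (g : Y →[G] Y') (a : M.obj X')
    (b : M.obj Y') : M.res (sumMap f g) (pair a b) = pair (M.res f a) (M.res g b) :=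
  sum_ext
    (by rw [res_inl_pair, res_res (h := comp (inl X' Y') f) (fun _ => rfl), res_comp, res_inl_pair])
    (by rw [res_inr_pair, res_res (h := comp (inr X' Y') g) (fun _ => rfl), res_comp, res_inr_pair])

theorem isPB_inl {X Y X' Y' : FinGSet G} (f : X →[G] X') (g : Y →[G] Y') :
    IsPB (inl X Y) f (sumMap f g) (inl X' Y') :=
  .mk' (fun _ => rfl) (fun a x h => by
    rcases sum_cases a with ⟨a, rfl⟩ | ⟨a, rfl⟩
    · exact ⟨a, rfl, inl_injective h⟩
    · exact absurd h (inr_ne_inl _ _)) (fun _ _ h _ => inl_injective h)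

theorem isPB_inr {X Y X' Y' : FinGSet G} (f : X →[G] X') (g : Y →[G] Y') :
    IsPB (inr X Y) g (sumMap f g) (inr X' Y') :=
  .mk' (fun _ => rfl) (fun a x h => by
    rcases sum_cases a with ⟨a, rfl⟩ | ⟨a, rfl⟩
    · exact absurd h (inl_ne_inr _ _)
    · exact ⟨a, rfl, inr_injective h⟩) (fun _ _ h _ => inr_injective h)

theorem tr_sumMap {X Y X' Y' : FinGSet G} (f : X →[G] X') (g : Y →[G] Y') (a : M.obj X)
    (b : M.obj Y) : M.tr (sumMap f g) (pair a b) = pair (M.tr f a) (M.tr g b) :=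
  sum_ext (by rw [res_inl_pair, ← mackey (isPB_inl f g), res_inl_pair])
    (by rw [res_inr_pair, ← mackey (isPB_inr f g), res_inr_pair])

theorem tr_copair {X Y Z : FinGSet G} (f : X →[G] Z) (g : Y →[G] Z) (a : M.obj X) (b : M.obj Y) :
    M.tr (copair f g) (pair a b) = M.tr (fold Z) (pair (M.tr f a) (M.tr g b)) := by
  rw [← tr_sumMap, tr_tr (h := copair f g)]
  intro x
  rcases sum_cases x with ⟨x, rfl⟩ | ⟨x, rfl⟩ <;> rfl


end

/-- The unique element of `M(∅)`. -/
noncomputable def emptyElt (X : FinGSet G) [h : IsEmpty X] : M.obj X :=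
  (M.isSemiMackey.existsUnique_empty X h).choose

/-- The commutative monoid structure on `M(X)` induced by the semi-Mackey structure: `a * b` is the
transfer along the folding map `X ⊔ X → X` of the element of `M(X ⊔ X) ≅ M(X) × M(X)` given by
`(a, b)`, and `1` is the transfer along `∅ → X` of the element of `M(∅)`. -/
noncomputable instance commMonoid (X : FinGSet G) : CommMonoid (M.obj X) where
  mul a b := M.tr (fold X) (pair a b)
  one := M.tr (elim (FinGSet.empty G) X) (M.emptyElt _)
  mul_comm a b := by
    change M.tr (fold X) (pair a b) = M.tr (fold X) (pair b a)
    have : pair a b = M.tr (copair (inr X X) (inl X X)) (pair b a) := by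
      have hb : Function.Bijective (copair (inr X X) (inl X X)) := by
        constructor
        · rintro (x | x) (y | y) h <;> cases h <;> rfl
        · rintro (x | x)
          exacts [⟨inr X X x, rfl⟩, ⟨inl X X x, rfl⟩]
      have h2 : M.res (copair (inr X X) (inl X X)) (pair a b) = pair b a := by
        rw [res_copair, res_inl_pair, res_inr_pair]
      rw [← h2, tr_res_of_bijective hb]
    rw [this, tr_tr (h := fold X)]
    rintro (x | x) <;> rfl
  mul_assoc a b c := by
    change M.tr (fold X) (pair (M.tr (fold X) (pair a b)) c)
      = M.tr (fold X) (pair a (M.tr (fold X) (pair b c)))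
    have h₁ := tr_copair (M := M) (fold X) (idHom X) (pair a b) c
    have h₂ := tr_copair (M := M) (idHom X) (fold X) a (pair b c)
    rw [tr_id] at h₁ h₂
    rw [← h₁, ← h₂]
    let α : sum (sum X X) X →[G] sum X (sum X X) :=
      copair (copair (inl _ _) (comp (inr _ _) (inl _ _))) (comp (inr _ _) (inr _ _))
    have hα : Function.Bijective α := by
      constructor
      · rintro ((x | x) | x) ((y | y) | y) h <;> cases h <;> rfl
      · rintro (x | (x | x))
        exacts [⟨Sum.inl (Sum.inl x), rfl⟩, ⟨Sum.inl (Sum.inr x), rfl⟩, ⟨Sum.inr x, rfl⟩]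
    have h3 : M.res α (pair a (pair b c)) = pair (pair a b) c := by
      rw [res_copair, res_copair, res_comp, res_comp, res_inl_pair, res_inr_pair, res_inl_pair,
        res_inr_pair]
    have h4 : pair a (pair b c) = M.tr α (pair (pair a b) c) := by rw [← h3, tr_res_of_bijective hα]
    rw [h4, tr_tr (h := copair (fold X) (idHom X))]
    rintro ((x | x) | x) <;> rfl
  one_mul a := by
    change M.tr (fold X) (pair (M.tr (elim (FinGSet.empty G) X) (M.emptyElt _)) a) = a
    have h₁ := tr_copair (M := M) (elim (FinGSet.empty G) X) (idHom X) (M.emptyElt _) a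
    rw [tr_id] at h₁
    rw [← h₁]
    have hb : Function.Bijective (copair (elim (FinGSet.empty G) X) (idHom X)) := by
      constructor
      · rintro (x | x) (y | y) h
        exacts [isEmptyElim x, isEmptyElim x, isEmptyElim y, congrArg _ h]
      · exact fun x => ⟨inr _ _ x, rfl⟩
    have h2 : M.res (copair (elim (FinGSet.empty G) X) (idHom X)) a = pair (M.emptyElt _) a := by
      rw [res_copair, res_id]
      congr 1
      exact empty_ext inferInstance _ _
    rw [← h2, tr_res_of_bijective hb]
  mul_one a := by
    change M.tr (fold X) (pair a (M.tr (elim (FinGSet.empty G) X) (M.emptyElt _))) = a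
    have h₁ := tr_copair (M := M) (idHom X) (elim (FinGSet.empty G) X) a (M.emptyElt _)
    rw [tr_id] at h₁
    rw [← h₁]
    have hb : Function.Bijective (copair (idHom X) (elim (FinGSet.empty G) X)) := by
      constructor
      · rintro (x | x) (y | y) h
        exacts [congrArg _ h, isEmptyElim y, isEmptyElim x, isEmptyElim x]
      · exact fun x => ⟨inl _ _ x, rfl⟩
    have h2 : M.res (copair (idHom X) (elim (FinGSet.empty G) X)) a = pair a (M.emptyElt _) := by
      rw [res_copair, res_id]
      congr 1
      exact empty_ext inferInstance _ _
    rw [← h2, tr_res_of_bijective hb]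

variable {M}

theorem mul_def {X : FinGSet G} (a b : M.obj X) : a * b = M.tr (fold X) (pair a b) := rfl

theorem one_def (X : FinGSet G) :
    (1 : M.obj X) = M.tr (elim (FinGSet.empty G) X) (M.emptyElt _) := rfl

theorem one_eq {E X : FinGSet G} [IsEmpty E] (f : E →[G] X) (c : M.obj E) : M.tr f c = 1 := by
  rw [one_def]
  have hb : Function.Bijective (elim (FinGSet.empty G) E) :=
    ⟨fun x => isEmptyElim x, fun x => isEmptyElim x⟩
  rw [← tr_res_of_bijective hb c, tr_tr (h := elim (FinGSet.empty G) X) (fun x => isEmptyElim x)]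
  congr 1
  exact empty_ext inferInstance _ _

theorem tr_copair' {X Y Z : FinGSet G} (f : X →[G] Z) (g : Y →[G] Z) (a : M.obj X) (b : M.obj Y) :
    M.tr (copair f g) (pair a b) = M.tr f a * M.tr g b := tr_copair f g a b

theorem tr_mul {X Y : FinGSet G} (f : X →[G] Y) (a b : M.obj X) :
    M.tr f (a * b) = M.tr f a * M.tr f b := by
  rw [← tr_copair', mul_def, tr_tr]
  rintro (x | x) <;> rfl

theorem tr_one {X Y : FinGSet G} (f : X →[G] Y) : M.tr f 1 = 1 := by
  rw [one_def, ← tr_comp, one_eq]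

theorem res_mul {X Y : FinGSet G} (f : X →[G] Y) (a b : M.obj Y) :
    M.res f (a * b) = M.res f a * M.res f b := by
  have h : IsPB (sumMap f f) (fold X) (fold Y) f := .mk'
    (by rintro (x | x) <;> rfl)
    (by
      rintro (y | y) x h
      exacts [⟨Sum.inl x, congrArg Sum.inl (h.symm : f x = y), rfl⟩,
        ⟨Sum.inr x, congrArg Sum.inr (h.symm : f x = y), rfl⟩])
    (by
      rintro (x | x) (y | y) h h'
      · exact congrArg Sum.inl (h' : x = y)
      · cases h
      · cases h
      · exact congrArg Sum.inr (h' : x = y))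
  rw [mul_def, ← mackey h, res_sumMap, mul_def]

theorem res_one {X Y : FinGSet G} (f : X →[G] Y) : M.res f 1 = 1 := by
  have h : IsPB (idHom (FinGSet.empty G)) (elim (FinGSet.empty G) X) (elim (FinGSet.empty G) Y) f :=
    .mk' (fun z => isEmptyElim z) (fun z => isEmptyElim z) (fun z => isEmptyElim z)
  rw [one_def, ← mackey h, one_eq]

/-- A semi-Mackey functor is a Mackey functor if each monoid `M(X)` is an (abelian) group. -/
def IsMackey (M : SemiMackey.{u, w} G) : Prop := ∀ (X : FinGSet G) (a : M.obj X), ∃ b, a * b = 1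

end SemiMackey

/-! ## Tambara functors -/

/-- A semi-Tambara functor on `G`: restrictions `res`, additive transfers `tr` and multiplicative
transfers `nm`. -/
structure SemiTambara (G : Type u) [Group G] where
  obj : FinGSet G → Type w
  res : ∀ {X Y : FinGSet G}, (X →[G] Y) → obj Y → obj X
  tr : ∀ {X Y : FinGSet G}, (X →[G] Y) → obj X → obj Y
  nm : ∀ {X Y : FinGSet G}, (X →[G] Y) → obj X → obj Y
  isSemiMackey_tr : IsSemiMackey obj res tr
  isSemiMackey_nm : IsSemiMackey obj res nm
  distrib : ∀ {X Y A Z B : FinGSet G} (f : X →[G] Y) (p : A →[G] X) (l : Z →[G] A) (r : Z →[G] B)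
    (q : B →[G] Y), IsExponential f p l r q →
    ∀ a : obj A, nm f (tr p a) = tr q (nm r (res l a))

namespace SemiTambara

variable (T : SemiTambara.{u, w} G)

/-- The additive part of `T`. -/
def additivePart : SemiMackey.{u, w} G := ⟨T.obj, T.res, T.tr, T.isSemiMackey_tr⟩

/-- The multiplicative part of `T`. -/
def multiplicativePart : SemiMackey.{u, w} G := ⟨T.obj, T.res, T.nm, T.isSemiMackey_nm⟩

/-- The addition on `T(X)`, coming from the additive part. -/
noncomputable instance (X : FinGSet G) : AddCommMonoid (T.obj X) :=
  letI := SemiMackey.commMonoid T.additivePart X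
  inferInstanceAs (AddCommMonoid (Additive (T.additivePart.obj X)))

/-- The multiplication on `T(X)`, coming from the multiplicative part. -/
noncomputable instance (X : FinGSet G) : CommMonoid (T.obj X) :=
  SemiMackey.commMonoid T.multiplicativePart X

end SemiTambara

/-- A Tambara functor on `G`: a semi-Tambara functor `T` such that each `T(X)` has additive
inverses, that is, is a ring. -/
structure Tambara (G : Type u) [Group G] extends SemiTambara.{u, w} G where
  isMackey : toSemiTambara.additivePart.IsMackey

end

/-! ## Operations on exponential diagrams -/

section

variable {G : Type u} [Group G]

namespace FinGSet

theorem IsPB.paste {P Q A X Y W : FinGSet G} {a : P →[G] A} {x : P →[G] X} {p : A →[G] Y}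
    {f : X →[G] Y} {b : Q →[G] P} {w : Q →[G] W} {g : W →[G] X} (h : IsPB a x p f)
    (h' : IsPB b w x g) : IsPB (comp a b) w p (comp f g) :=
  .mk' (fun z => (h.comm _).trans (congrArg f (h'.comm z)))
    (fun a₀ w₀ e => by
      obtain ⟨z, h₁, h₂⟩ := h.exists (x₀ := g w₀) e
      obtain ⟨t, h₃, h₄⟩ := h'.exists h₂
      exact ⟨t, (congrArg a h₃).trans h₁, h₄⟩)
    (fun z z' h₁ h₂ => h'.ext (h.ext h₁ (by rw [h'.comm, h'.comm, h₂])) h₂)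

theorem isPB_of_bijective {P A X Y : FinGSet G} {a : P →[G] A} {x : P →[G] X} {p : A →[G] Y}
    {f : X →[G] Y} (ha : Function.Bijective a) (hf : Function.Bijective f)
    (comm : ∀ z, p (a z) = f (x z)) : IsPB a x p f :=
  .mk' comm (fun a₀ x₀ e => by
    obtain ⟨z, hz⟩ := ha.2 a₀
    exact ⟨z, hz, hf.1 (by rw [← comm, hz, e])⟩) (fun _ _ h _ => ha.1 h)

theorem isExp_id {X A : FinGSet G} (p : A →[G] X) :
    IsExp (idHom X) p (idHom A) (idHom A) p where
  isPB := .mk' (fun _ => rfl) (fun a _ e => ⟨a, rfl, e⟩) (fun _ _ h _ => h)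
  ex s := ⟨s.sec ⟨s.pt, rfl⟩, s.sec_spec _, fun z h e => by
    obtain rfl : z = _ := e
    exact s.sec_congr _ h.symm⟩
  un b b' h h' := h' b b' rfl rfl h

theorem isExp_idSection {X Y : FinGSet G} (f : X →[G] Y) :
    IsExp f (idHom X) (idHom X) f (idHom Y) where
  isPB := .mk' (fun _ => rfl) (fun _ x e => ⟨x, e.symm, rfl⟩) (fun _ _ _ h => h)
  ex s := ⟨s.pt, rfl, fun _ h _ => (s.sec_spec ⟨_, h⟩).symm⟩
  un _ _ h _ := h

theorem IsExp.comp {X Y W A B Z B₂ Z₂ P : FinGSet G} {f : X →[G] Y} {p : A →[G] X} {l : Z →[G] A}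
    {r : Z →[G] B} {q : B →[G] Y} (h₁ : IsExp f p l r q) {g : Y →[G] W} {l₂ : Z₂ →[G] B}
    {r₂ : Z₂ →[G] B₂} {q₂ : B₂ →[G] W} (h₂ : IsExp g q l₂ r₂ q₂) {c : P →[G] Z} {d : P →[G] Z₂}
    (hP : IsPB c d r l₂) : IsExp (comp g f) p (comp l c) (comp r₂ d) q₂ where
  isPB := .mk'
    (fun t => by
      have e₁ := h₂.isPB.comm (d t)
      have e₂ := h₁.isPB.comm (c t)
      have e₃ := hP.comm t
      simp only [comp_apply] at e₁ e₂ ⊢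
      rw [e₁, ← e₃, e₂])
    (fun b x e => by
      obtain ⟨z₂, hz₂, hz₂'⟩ := h₂.isPB.exists (a₀ := b) (x₀ := f x) e
      obtain ⟨z, hz, hz'⟩ := h₁.isPB.exists (a₀ := l₂ z₂) (x₀ := x) hz₂'
      obtain ⟨t, ht, ht'⟩ := hP.exists hz
      exact ⟨t, by simp only [comp_apply, ht', hz₂], by
        simp only [comp_apply] at hz' ⊢; rw [ht, hz']⟩)
    (fun t t' e e' => by
      simp only [comp_apply] at e e'
      have hd : d t = d t' := by
        refine h₂.isPB.ext e ?_
        have e₂ := h₁.isPB.comm (c t)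
        have e₂' := h₁.isPB.comm (c t')
        simp only [comp_apply] at e₂ e₂' ⊢
        rw [← hP.comm, ← hP.comm, e₂, e₂', e']
      refine hP.ext (h₁.isPB.ext ?_ e') hd
      rw [hP.comm, hP.comm, hd])
  ex s := by
    let σ : ∀ y : Y, g y = s.pt → Sections f p := fun y hy =>
      ⟨y, fun x => s.sec ⟨x.1, (congrArg g x.2).trans hy⟩, fun x => s.sec_spec _⟩
    let τ : Sections g q :=
      ⟨s.pt, fun y => (h₁.ex (σ y.1 y.2)).choose, fun y => (h₁.ex (σ y.1 y.2)).choose_spec.1⟩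
    obtain ⟨b, hb, hb'⟩ := h₂.ex τ
    refine ⟨b, hb, fun t ht e => ?_⟩
    simp only [comp_apply] at e ht ⊢
    have e₂ := h₁.isPB.comm (c t)
    have e₃ := hP.comm t
    simp only [comp_apply] at e₂
    have hy : g (q (l₂ (d t))) = s.pt := by rw [← e₃, e₂]; exact ht
    have h5 := hb' (d t) hy e
    have h6 := (h₁.ex (σ _ hy)).choose_spec.2 (c t) (by
      change f (p (l (c t))) = q (l₂ (d t)); rw [← e₂, e₃]) (e₃.trans h5)
    exact h6
  un b b' e h := by
    refine h₂.un b b' e (fun z₂ z₂' hz hz' ee => h₁.un _ _ ee (fun z z' hr hr' ez => ?_))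
    obtain ⟨t, ht, ht'⟩ := hP.exists hr
    obtain ⟨t', ht₁, ht₁'⟩ := hP.exists hr'
    have := h t t' (by simp only [comp_apply, ht', hz]) (by simp only [comp_apply, ht₁', hz'])
      (by simp only [comp_apply, ht, ht₁, ez])
    simpa only [comp_apply, ht, ht₁] using this

theorem IsExp.baseChange {X Y X' Y' A B Z A' B' Z' : FinGSet G} {y : Y' →[G] Y} {p : A →[G] Y'}
    {l : Z →[G] A} {r : Z →[G] B} {q : B →[G] Y} (h : IsExp y p l r q) {f' : X' →[G] Y'}
    {x : X' →[G] X} {f : X →[G] Y} (hX : IsPB f' x y f) {p' : A' →[G] X'} {a : A' →[G] A}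
    (hA : IsPB a p' p f') {q' : B' →[G] X} {b : B' →[G] B} (hB : IsPB b q' q f) {r' : Z' →[G] B'}
    {c : Z' →[G] Z} (hZ : IsPB c r' r b) {l' : Z' →[G] A'} (hl : ∀ z, a (l' z) = l (c z))
    (hl' : ∀ z, x (p' (l' z)) = q' (r' z)) : IsExp x p' l' r' q' where
  isPB := .mk' (fun z => (hl' z).symm)
    (fun b₀ x₀ e => by
      have e₁ : q (b b₀) = y (f' x₀) := by rw [hB.comm, hX.comm, e]
      obtain ⟨z, hz, hz'⟩ := h.isPB.exists e₁
      obtain ⟨t, ht, ht'⟩ := hZ.exists hz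
      refine ⟨t, ht', hX.ext ?_ ?_⟩
      · rw [comp_apply, ← hA.comm, hl, ht]; exact hz'
      · rw [comp_apply, hl', ht', e])
    (fun t t' e e' => by
      refine hZ.ext (h.isPB.ext ?_ ?_) e
      · rw [hZ.comm, hZ.comm, e]
      · simp only [comp_apply] at e' ⊢
        rw [← hl, ← hl, hA.comm, hA.comm, e'])
  ex s := by
    have lift : ∀ y₀, y y₀ = f s.pt → ∃ x₀, f' x₀ = y₀ ∧ x x₀ = s.pt := fun y₀ e => hX.exists e
    choose u hu hu' using lift
    let σ : Sections y p := ⟨f s.pt, fun y₀ => a (s.sec ⟨u y₀.1 y₀.2, hu' _ _⟩), fun y₀ => by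
      rw [hA.comm, s.sec_spec, hu]⟩
    obtain ⟨b₀, hb₀, hb₀'⟩ := h.ex σ
    obtain ⟨t, ht, ht'⟩ := hB.exists (a₀ := b₀) (x₀ := s.pt) hb₀
    refine ⟨t, ht', fun z hz e => hA.ext ?_ ?_⟩
    · have e₀ : y (p (l (c z))) = f s.pt := by rw [← hl, hA.comm, hX.comm, hz]
      rw [hl, hb₀' (c z) e₀ (by rw [hZ.comm, e, ht])]
      refine congrArg a (s.sec_congr _ (hX.ext ?_ ?_))
      · refine (hu _ _).trans ?_
        change p (l (c z)) = _
        rw [← hl, hA.comm]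
      · rw [hu', hz]
    · exact (s.sec_spec ⟨_, hz⟩).symm
  un b₀ b₁ e hh := by
    refine hB.ext (h.un _ _ (by rw [hB.comm, hB.comm, e]) (fun z z' hz hz' ez => ?_)) e
    obtain ⟨t, ht, ht'⟩ := hZ.exists hz
    obtain ⟨t', ht₁, ht₁'⟩ := hZ.exists hz'
    have := hh t t' ht' ht₁' (hX.ext (by rw [← hA.comm, ← hA.comm, hl, hl, ht, ht₁, ez])
      (by rw [hl', hl', ht', ht₁', e]))
    rw [← ht, ← ht₁, ← hl, ← hl, this]

theorem piEval_eq {X Y A : FinGSet G} {f : X →[G] Y} {p : A →[G] X} {z : PiTot f p}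
    {s : Sections f p} (e : piMap f p z = s) (h : f (pbFst f (piProj f p) z) = s.pt) :
    piEval f p z = s.sec ⟨pbFst f (piProj f p) z, h⟩ := by
  subst e; rfl

section

variable {X Y A C P : FinGSet G} (f : X →[G] Y) (p : A →[G] X) (k : C →[G] A)

/-- The map `Π_f(C) → Π_f(A)` induced by a map `k : C → A` over `X`. -/
def piPost : Pi f (comp p k) →[G] Pi f p :=
  mkHom (X := Pi f (comp p k)) (Y := Pi f p)
    (fun s : Sections f (comp p k) => (⟨s.pt, fun x => k (s.sec x), s.sec_spec⟩ : Sections f p))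
    (fun _ _ => Sections.ext' rfl (fun _ _ _ => map_act k _ _))

/-- The map `X ×_Y Π_f(C) → X ×_Y Π_f(A)` induced by a map `k : C → A` over `X`. -/
def piTotPost : PiTot f (comp p k) →[G] PiTot f p :=
  mkHom (fun z => pbMk (pbFst f (piProj f (comp p k)) z)
    (piPost f p k (pbSnd f (piProj f (comp p k)) z)) z.2)
    (fun g _ => pbExt rfl (map_act (piPost f p k) g _))

variable {f p k}

theorem piEval_post (z : PiTot f (comp p k)) :
    piEval f p (piTotPost f p k z) = k (piEval f (comp p k) z) := rfl

theorem isPB_piTotPost :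
    IsPB (piTotPost f p k) (piMap f (comp p k)) (piMap f p) (piPost f p k) :=
  .mk' (fun _ => rfl)
    (fun z s e => ⟨pbMk (pbFst f (piProj f p) z) s
      ((pb_comm f (piProj f p) z).trans (congrArg (piProj f p) e)), pbExt rfl e.symm, rfl⟩)
    (fun _ _ h h' => pbExt (congrArg (pbFst f (piProj f p)) h) h')

theorem isExp_post {a : P →[G] C} {x : P →[G] PiTot f p} (hP : IsPB a x k (piEval f p))
    {l : PiTot f (comp p k) →[G] P} (hl : ∀ z, a (l z) = piEval f (comp p k) z)
    (hl' : ∀ z, x (l z) = piTotPost f p k z) :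
    IsExp (piMap f p) x l (piMap f (comp p k)) (piPost f p k) where
  isPB := by
    have := (isPB_piTotPost (f := f) (p := p) (k := k)).flip
    refine .mk' (fun z => ?_) (fun s z e => ?_) (fun z z' h h' => ?_)
    · rw [comp_apply, hl']; rfl
    · obtain ⟨t, ht, ht'⟩ := this.exists e
      exact ⟨t, ht, by rw [comp_apply, hl', ht']⟩
    · rw [comp_apply, comp_apply, hl', hl'] at h'
      exact this.ext h h'
  ex s := by
    let pt' : Sections f p := s.pt
    let σ : Sections f (comp p k) :=
      ⟨pt'.pt, fun y => a (s.sec ⟨pbMk (p := f) (f := piProj f p) y.1 s.pt y.2, rfl⟩), fun y => by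
        rw [comp_apply, hP.comm, piEval_spec, s.sec_spec]; rfl⟩
    refine ⟨σ, Sections.ext' rfl (fun y hs ht => ?_), fun z h e => ?_⟩
    · change k (a (s.sec ⟨_, _⟩)) = _
      rw [hP.comm, s.sec_spec]; rfl
    · refine hP.ext ?_ ?_
      · have h₁ : f (pbFst f (piProj f (comp p k)) z) = σ.pt := (pb_comm _ _ _).trans (congrArg (piProj f (comp p k)) e)
        rw [hl, piEval_eq e h₁]
        refine congrArg a (s.sec_congr _ (pbExt ?_ ?_))
        · rw [hl']; rfl
        · exact h.symm
      · exact (s.sec_spec ⟨_, h⟩).symm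
  un s s' h₀ h := by
    have e' : Sections.pt s = Sections.pt s' := congrArg (piProj f p) h₀
    refine Sections.ext' e' (fun y hs ht => ?_)
    have := h (pbMk (p := f) (f := piProj f _) y s hs) (pbMk (p := f) (f := piProj f _) y s' ht) rfl rfl
      (by rw [hl', hl']; exact pbExt rfl h₀)
    have := congrArg a this
    rwa [hl, hl] at this

end

end FinGSet

end

/-! ## Semi-Tambara functors presented by symbols -/

section

variable {G : Type u} [Group G]

open FinGSet

/-- It is enough to check the distributive law on canonical exponential diagrams. -/
theorem distrib_of_canonical {obj : FinGSet G → Type w}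
    {res : ∀ {X Y : FinGSet G}, (X →[G] Y) → obj Y → obj X}
    {tr nm : ∀ {X Y : FinGSet G}, (X →[G] Y) → obj X → obj Y}
    (ht : IsSemiMackey obj res tr) (hn : IsSemiMackey obj res nm)
    (h : ∀ {X Y A : FinGSet G} (f : X →[G] Y) (p : A →[G] X) (a : obj A),
      nm f (tr p a) = tr (piProj f p) (nm (piMap f p) (res (piEval f p) a)))
    {X Y A Z B : FinGSet G} (f : X →[G] Y) (p : A →[G] X) (l : Z →[G] A) (r : Z →[G] B)
    (q : B →[G] Y) (he : IsExponential f p l r q) (a : obj A) :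
    nm f (tr p a) = tr q (nm r (res l a)) := by
  obtain ⟨b, z, hb, hz, h₁, h₂, h₃⟩ := he
  have e₁ : q = comp (piProj f p) b := homExt fun t => (h₁ t).symm
  have e₂ : l = comp (piEval f p) z := homExt fun t => (h₂ t).symm
  rw [h, e₁, e₂, ht.tr_comp, ht.res_comp,
    hn.mackey z r (piMap f p) b (isPB_of_bijective hz hb h₃)]
  exact congrArg _ (SemiMackey.tr_res_of_bijective (M := ⟨obj, res, tr, ht⟩) hb _).symm

/-- A symbol over `X` with values in `M`: a map `p : A → X` of finite `G`-sets and an element of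
`M(A)`. -/
structure GSymbol (M : SemiMackey.{u, w} G) (X : FinGSet G) where
  base : FinGSet G
  map : base →[G] X
  val : M.obj base

namespace GSymbol

variable {M : SemiMackey.{u, w} G}

/-- Restriction of `(p : B → Y, m)` along `f : X → Y`: `(X ×_Y B → X, M^*(p_B)(m))`. -/
def res {X Y : FinGSet G} (f : X →[G] Y) (s : GSymbol M Y) : GSymbol M X :=
  ⟨pb s.map f, pbSnd s.map f, M.res (pbFst s.map f) s.val⟩

/-- Additive transfer of `(p : A → X, m)` along `f : X → Y`: `(f ∘ p : A → Y, m)`. -/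
def tr {X Y : FinGSet G} (f : X →[G] Y) (s : GSymbol M X) : GSymbol M Y := ⟨s.base, comp f s.map, s.val⟩

/-- Multiplicative transfer of `(p : A → X, m)` along `f : X → Y`:
`(π : Π_f(A) → Y, M_*(f') M^*(e)(m))`. -/
def nm {X Y : FinGSet G} (f : X →[G] Y) (s : GSymbol M X) : GSymbol M Y :=
  ⟨Pi f s.map, piProj f s.map, M.tr (piMap f s.map) (M.res (piEval f s.map) s.val)⟩

/-- The disjoint union of a symbol over `X` and a symbol over `Y`. -/
noncomputable def sum {X Y : FinGSet G} (s : GSymbol M X) (t : GSymbol M Y) : GSymbol M (FinGSet.sum X Y) :=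
  ⟨FinGSet.sum s.base t.base, sumMap s.map t.map, SemiMackey.pair s.val t.val⟩

/-- An isomorphism of symbols over `X`. -/
def Iso {X : FinGSet G} (s t : GSymbol M X) : Prop :=
  ∃ a : s.base →[G] t.base, Function.Bijective a ∧ (∀ z, t.map (a z) = s.map z) ∧
    s.val = M.res a t.val

end GSymbol

/-- A family of relations on symbols with values in `M`, such that the generated equivalence
relation contains the isomorphisms and is compatible with the operations on symbols. -/
structure SymRel (M : SemiMackey.{u, w} G) where
  rel : ∀ {X : FinGSet G}, GSymbol M X → GSymbol M X → Prop
  iso : ∀ {X : FinGSet G} {s t : GSymbol M X}, s.Iso t → Quot.mk rel s = Quot.mk rel t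
  res : ∀ {X Y : FinGSet G} (f : X →[G] Y) {s t : GSymbol M Y}, rel s t →
    Quot.mk rel (s.res f) = Quot.mk rel (t.res f)
  tr : ∀ {X Y : FinGSet G} (f : X →[G] Y) {s t : GSymbol M X}, rel s t →
    Quot.mk rel (s.tr f) = Quot.mk rel (t.tr f)
  nm : ∀ {X Y : FinGSet G} (f : X →[G] Y) {s t : GSymbol M X}, rel s t →
    Quot.mk rel (s.nm f) = Quot.mk rel (t.nm f)
  sum_left : ∀ {X Y : FinGSet G} {s t : GSymbol M X} (s' : GSymbol M Y), rel s t →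
    Quot.mk rel (s.sum s') = Quot.mk rel (t.sum s')
  sum_right : ∀ {X Y : FinGSet G} (s' : GSymbol M X) {s t : GSymbol M Y}, rel s t →
    Quot.mk rel (s'.sum s) = Quot.mk rel (s'.sum t)

namespace SymRel

variable {M : SemiMackey.{u, w} G} (R : SymRel M)

/-- Classes of symbols over `X`. -/
def Q (X : FinGSet G) : Type (max (u+1) w) := Quot (R.rel (X := X))

/-- The class of a symbol. -/
def cls {X : FinGSet G} (s : GSymbol M X) : R.Q X := Quot.mk _ s

def resQ {X Y : FinGSet G} (f : X →[G] Y) : R.Q Y → R.Q X :=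
  Quot.lift (fun s => R.cls (s.res f)) (fun _ _ h => R.res f h)

def trQ {X Y : FinGSet G} (f : X →[G] Y) : R.Q X → R.Q Y :=
  Quot.lift (fun s => R.cls (s.tr f)) (fun _ _ h => R.tr f h)

def nmQ {X Y : FinGSet G} (f : X →[G] Y) : R.Q X → R.Q Y :=
  Quot.lift (fun s => R.cls (s.nm f)) (fun _ _ h => R.nm f h)

noncomputable def sumQ {X Y : FinGSet G} : R.Q X → R.Q Y → R.Q (FinGSet.sum X Y) :=
  Quot.lift₂ (fun s t => R.cls (s.sum t)) (fun s _ _ h => R.sum_right s h)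
    (fun _ _ s h => R.sum_left s h)

variable {R}

theorem cls_surj {X : FinGSet G} (c : R.Q X) : ∃ s, R.cls s = c := Quot.exists_rep c

theorem cls_iso {X A B : FinGSet G} {p : A →[G] X} {q : B →[G] X} {m : M.obj A} {n : M.obj B}
    (a : A →[G] B) (ha : Function.Bijective a) (hp : ∀ z, q (a z) = p z) (hm : m = M.res a n) :
    R.cls ⟨A, p, m⟩ = R.cls ⟨B, q, n⟩ := R.iso ⟨a, ha, hp, hm⟩

theorem cls_congr {X A : FinGSet G} {p q : A →[G] X} {m n : M.obj A} (hp : ∀ z, q z = p z)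
    (hm : m = n) : R.cls ⟨A, p, m⟩ = R.cls ⟨A, q, n⟩ := by
  obtain rfl : p = q := homExt fun z => (hp z).symm
  rw [hm]

theorem resQ_mk {X Y A P : FinGSet G} (f : X →[G] Y) {p : A →[G] Y} (m : M.obj A) {a : P →[G] A}
    {x : P →[G] X} (h : IsPB a x p f) : R.resQ f (R.cls ⟨A, p, m⟩) = R.cls ⟨P, x, M.res a m⟩ := by
  let k : P →[G] pb p f := (isPB_pb p f).lift a x h.comm
  have h₁ : ∀ z, pbFst p f (k z) = a z := (isPB_pb p f).lift_fst a x h.comm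
  have h₂ : ∀ z, pbSnd p f (k z) = x z := (isPB_pb p f).lift_snd a x h.comm
  have hk : Function.Bijective k := by
    refine ⟨fun z z' e => h.ext (by rw [← h₁, ← h₁, e]) (by rw [← h₂, ← h₂, e]), fun t => ?_⟩
    obtain ⟨z, hz, hz'⟩ := h.exists (pb_comm p f t)
    exact ⟨z, pbExt ((h₁ z).trans hz) ((h₂ z).trans hz')⟩
  exact (cls_iso k hk h₂ (SemiMackey.res_res (M := M) (fun z => (h₁ z).symm) m).symm).symm

theorem trQ_mk {X Y A : FinGSet G} (f : X →[G] Y) (p : A →[G] X) (m : M.obj A) :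
    R.trQ f (R.cls ⟨A, p, m⟩) = R.cls ⟨A, comp f p, m⟩ := rfl

theorem nmQ_mk {X Y A Z B : FinGSet G} {f : X →[G] Y} {p : A →[G] X} {l : Z →[G] A}
    {r : Z →[G] B} {q : B →[G] Y} (h : IsExp f p l r q) (m : M.obj A) :
    R.nmQ f (R.cls ⟨A, p, m⟩) = R.cls ⟨B, q, M.tr r (M.res l m)⟩ := by
  obtain ⟨b, z, hb, hz, h₁, h₂, h₃⟩ := h.isExponential
  refine (cls_iso b hb h₁ ?_).symm
  rw [← SemiMackey.mackey (isPB_of_bijective hz hb h₃), SemiMackey.res_res (fun t => (h₂ t).symm)]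

theorem sumQ_mk {X Y A B : FinGSet G} (p : A →[G] X) (q : B →[G] Y) (m : M.obj A) (n : M.obj B) :
    R.sumQ (R.cls ⟨A, p, m⟩) (R.cls ⟨B, q, n⟩)
      = R.cls ⟨FinGSet.sum A B, sumMap p q, SemiMackey.pair m n⟩ := rfl

theorem resQ_inl_sumQ {X Y : FinGSet G} (c : R.Q X) (d : R.Q Y) :
    R.resQ (inl X Y) (R.sumQ c d) = c := by
  obtain ⟨⟨A, p, m⟩, rfl⟩ := cls_surj c
  obtain ⟨⟨B, q, n⟩, rfl⟩ := cls_surj d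
  rw [sumQ_mk, resQ_mk _ _ (SemiMackey.isPB_inl p q), SemiMackey.res_inl_pair]

theorem resQ_inr_sumQ {X Y : FinGSet G} (c : R.Q X) (d : R.Q Y) :
    R.resQ (inr X Y) (R.sumQ c d) = d := by
  obtain ⟨⟨A, p, m⟩, rfl⟩ := cls_surj c
  obtain ⟨⟨B, q, n⟩, rfl⟩ := cls_surj d
  rw [sumQ_mk, resQ_mk _ _ (SemiMackey.isPB_inr p q), SemiMackey.res_inr_pair]

theorem sumQ_resQ {X Y : FinGSet G} (c : R.Q (FinGSet.sum X Y)) :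
    R.sumQ (R.resQ (inl X Y) c) (R.resQ (inr X Y) c) = c := by
  obtain ⟨⟨A, p, m⟩, rfl⟩ := cls_surj c
  rw [resQ_mk _ _ (isPB_pb _ _), resQ_mk _ _ (isPB_pb _ _), sumQ_mk]
  refine cls_iso (copair (pbFst p (inl X Y)) (pbFst p (inr X Y))) ⟨?_, ?_⟩ ?_ ?_
  · intro z z' e
    rcases sum_cases z with ⟨z, rfl⟩ | ⟨z, rfl⟩ <;> rcases sum_cases z' with ⟨z', rfl⟩ | ⟨z', rfl⟩
    · exact congrArg _ (pbExt e (inl_injective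
        ((pb_comm _ _ z).symm.trans ((congrArg p e).trans (pb_comm _ _ z')))))
    · exact absurd ((pb_comm _ _ z).symm.trans ((congrArg p e).trans (pb_comm _ _ z')))
        (inl_ne_inr _ _)
    · exact absurd ((pb_comm _ _ z).symm.trans ((congrArg p e).trans (pb_comm _ _ z')))
        (inr_ne_inl _ _)
    · exact congrArg _ (pbExt e (inr_injective
        ((pb_comm _ _ z).symm.trans ((congrArg p e).trans (pb_comm _ _ z')))))
  · intro a
    rcases sum_cases (p a) with ⟨x, hx⟩ | ⟨x, hx⟩
    · exact ⟨inl _ _ (pbMk a x hx), rfl⟩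
    · exact ⟨inr _ _ (pbMk a x hx), rfl⟩
  · intro z
    rcases sum_cases z with ⟨z, rfl⟩ | ⟨z, rfl⟩
    · exact pb_comm p (inl X Y) z
    · exact pb_comm p (inr X Y) z
  · rw [SemiMackey.res_copair]

theorem resQ_id {X : FinGSet G} (c : R.Q X) : R.resQ (idHom X) c = c := by
  obtain ⟨⟨A, p, m⟩, rfl⟩ := cls_surj c
  rw [resQ_mk _ _ (a := idHom A) (x := p) (.mk' (fun _ => rfl) (fun a _ e => ⟨a, rfl, e⟩)
    (fun _ _ h _ => h)), SemiMackey.res_id]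

theorem resQ_comp {X Y Z : FinGSet G} (f : X →[G] Y) (g : Y →[G] Z) (c : R.Q Z) :
    R.resQ (comp g f) c = R.resQ f (R.resQ g c) := by
  obtain ⟨⟨A, p, m⟩, rfl⟩ := cls_surj c
  rw [resQ_mk g _ (isPB_pb _ _), resQ_mk f _ (isPB_pb _ _),
    resQ_mk _ _ ((isPB_pb p g).paste (isPB_pb _ f)), SemiMackey.res_comp]

theorem bijective_sumQ (X Y : FinGSet G) : Function.Bijective
    fun c : R.Q (FinGSet.sum X Y) => (R.resQ (inl X Y) c, R.resQ (inr X Y) c) := by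
  refine ⟨fun c d e => ?_, fun c => ⟨R.sumQ c.1 c.2, ?_⟩⟩
  · rw [← sumQ_resQ c, ← sumQ_resQ d]
    exact congrArg₂ _ (congrArg Prod.fst e) (congrArg Prod.snd e)
  · exact Prod.ext (resQ_inl_sumQ _ _) (resQ_inr_sumQ _ _)

theorem existsUnique_emptyQ (X : FinGSet G) (h : IsEmpty X) : ∃! _ : R.Q X, True := by
  refine ⟨R.cls ⟨X, idHom X, M.emptyElt X⟩, trivial, fun c _ => ?_⟩
  obtain ⟨⟨A, p, m⟩, rfl⟩ := cls_surj c
  have hA : IsEmpty A := ⟨fun a => h.elim (p a)⟩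
  exact cls_iso p ⟨fun a => hA.elim a, fun x => h.elim x⟩ (fun a => hA.elim a)
    (SemiMackey.empty_ext hA _ _)

theorem isSemiMackey_trQ : IsSemiMackey R.Q R.resQ R.trQ where
  res_id := resQ_id
  res_comp := resQ_comp
  tr_id c := by obtain ⟨⟨A, p, m⟩, rfl⟩ := cls_surj c; rfl
  tr_comp f g c := by obtain ⟨⟨A, p, m⟩, rfl⟩ := cls_surj c; rfl
  bijective_sum := bijective_sumQ
  existsUnique_empty := existsUnique_emptyQ
  mackey f' x y f h c := by
    obtain ⟨⟨A, p, m⟩, rfl⟩ := cls_surj c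
    rw [trQ_mk, resQ_mk _ _ (isPB_pb _ _), trQ_mk,
      resQ_mk _ _ (h.flip.paste (isPB_pb p f').flip).flip]

theorem isSemiMackey_nmQ : IsSemiMackey R.Q R.resQ R.nmQ where
  res_id := resQ_id
  res_comp := resQ_comp
  tr_id c := by
    obtain ⟨⟨A, p, m⟩, rfl⟩ := cls_surj c
    rw [nmQ_mk (isExp_id p), SemiMackey.res_id, SemiMackey.tr_id]
  tr_comp f g c := by
    obtain ⟨⟨A, p, m⟩, rfl⟩ := cls_surj c
    have h₁ := isExp_canonical f p
    have h₂ := isExp_canonical g (piProj f p)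
    have hP := isPB_pb (piMap f p) (piEval g (piProj f p))
    rw [nmQ_mk h₁, nmQ_mk h₂, nmQ_mk (h₁.comp h₂ hP), SemiMackey.tr_comp, SemiMackey.res_comp,
      ← SemiMackey.mackey hP]
  bijective_sum := bijective_sumQ
  existsUnique_empty := existsUnique_emptyQ
  mackey f' x y f h c := by
    obtain ⟨⟨A, p, m⟩, rfl⟩ := cls_surj c
    have h₁ := isExp_canonical y p
    have hA := isPB_pb p f'
    have hB := isPB_pb (piProj y p) f
    have hZ := isPB_pb (piMap y p) (pbFst (piProj y p) f)
    have e₁ : ∀ z, y (comp p (comp (piEval y p) (pbFst _ _)) z)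
        = f (comp (pbSnd (piProj y p) f) (pbSnd (piMap y p) (pbFst (piProj y p) f)) z) := by
      intro z
      have a₁ := h₁.isPB.comm (pbFst (piMap y p) (pbFst (piProj y p) f) z)
      have a₂ := hB.comm (pbSnd (piMap y p) (pbFst (piProj y p) f) z)
      have a₃ := hZ.comm z
      simp only [comp_apply] at a₁ a₂ a₃ ⊢
      rw [← a₁, ← a₂, a₃]
    let k := h.lift _ _ e₁
    have hk : ∀ z, f' (k z) = _ := h.lift_fst _ _ e₁
    have hk' : ∀ z, x (k z) = _ := h.lift_snd _ _ e₁
    let l' := hA.lift (comp (piEval y p) (pbFst _ _)) k (fun z => (hk z).symm)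
    have hl : ∀ z, pbFst p f' (l' z) = _ := hA.lift_fst _ _ (fun z => (hk z).symm)
    have hl' : ∀ z, pbSnd p f' (l' z) = _ := hA.lift_snd _ _ (fun z => (hk z).symm)
    have key := h₁.baseChange h hA hB hZ hl (fun z => by rw [hl', hk']; rfl)
    rw [resQ_mk _ _ hA, nmQ_mk key, nmQ_mk h₁, resQ_mk _ _ hB, SemiMackey.res_res (h := comp
      (piEval y p) (pbFst (piMap y p) (pbFst (piProj y p) f))) (fun z => (hl z).symm),
      ← SemiMackey.mackey hZ, SemiMackey.res_comp]

/-- The semi-Tambara functor of classes of symbols. -/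
def semiTambara (R : SymRel M) : SemiTambara.{u, max (u+1) w} G where
  obj := R.Q
  res := R.resQ
  tr := R.trQ
  nm := R.nmQ
  isSemiMackey_tr := isSemiMackey_trQ
  isSemiMackey_nm := isSemiMackey_nmQ
  distrib := distrib_of_canonical isSemiMackey_trQ isSemiMackey_nmQ (fun f p c => by
    obtain ⟨⟨C, k, m⟩, rfl⟩ := cls_surj c
    have hP := isPB_pb k (piEval f p)
    have e : ∀ z, k (piEval f (comp p k) z) = piEval f p (piTotPost f p k z) :=
      fun z => (piEval_post z).symm
    have h := isExp_post hP (hP.lift_fst _ _ e) (hP.lift_snd _ _ e)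
    rw [trQ_mk, nmQ_mk (isExp_canonical f (comp p k)), resQ_mk _ _ hP, nmQ_mk h, trQ_mk,
      SemiMackey.res_res (fun z => (hP.lift_fst _ _ e z).symm)]
    rfl)

end SymRel

end

/-! ## Morphisms, and the tensor product of Tambara functors -/

section

variable {G : Type u} [Group G]

open FinGSet

namespace SemiTambara

section

variable {T : SemiTambara.{u, w} G}

theorem res_id {X : FinGSet G} (a : T.obj X) : T.res (idHom X) a = a := T.isSemiMackey_tr.res_id a

theorem res_res {X Y Z : FinGSet G} {f : X →[G] Y} {g : Y →[G] Z} {h : X →[G] Z}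
    (e : ∀ x, h x = g (f x)) (a : T.obj Z) : T.res f (T.res g a) = T.res h a :=
  SemiMackey.res_res (M := T.additivePart) e a

theorem res_sq {X Y Y' Z : FinGSet G} {f : X →[G] Y} {g : Y →[G] Z} {f' : X →[G] Y'}
    {g' : Y' →[G] Z} (e : ∀ x, g (f x) = g' (f' x)) (a : T.obj Z) :
    T.res f (T.res g a) = T.res f' (T.res g' a) := by
  rw [res_res (h := comp g f) (fun _ => rfl), res_res (h := comp g f) e]

theorem tr_id {X : FinGSet G} (a : T.obj X) : T.tr (idHom X) a = a := T.isSemiMackey_tr.tr_id a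

theorem nm_id {X : FinGSet G} (a : T.obj X) : T.nm (idHom X) a = a := T.isSemiMackey_nm.tr_id a

theorem tr_tr {X Y Z : FinGSet G} {f : X →[G] Y} {g : Y →[G] Z} {h : X →[G] Z}
    (e : ∀ x, h x = g (f x)) (a : T.obj X) : T.tr g (T.tr f a) = T.tr h a :=
  SemiMackey.tr_tr (M := T.additivePart) e a

theorem mackey_tr {X' Y' X Y : FinGSet G} {f' : X' →[G] Y'} {x : X' →[G] X} {y : Y' →[G] Y}
    {f : X →[G] Y} (h : IsPB f' x y f) (c : T.obj Y') : T.tr x (T.res f' c) = T.res f (T.tr y c) :=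
  T.isSemiMackey_tr.mackey f' x y f h c

theorem mackey_nm {X' Y' X Y : FinGSet G} {f' : X' →[G] Y'} {x : X' →[G] X} {y : Y' →[G] Y}
    {f : X →[G] Y} (h : IsPB f' x y f) (c : T.obj Y') : T.nm x (T.res f' c) = T.res f (T.nm y c) :=
  T.isSemiMackey_nm.mackey f' x y f h c

theorem distrib' {X Y A Z B : FinGSet G} {f : X →[G] Y} {p : A →[G] X} {l : Z →[G] A}
    {r : Z →[G] B} {q : B →[G] Y} (h : IsExp f p l r q) (a : T.obj A) :
    T.nm f (T.tr p a) = T.tr q (T.nm r (T.res l a)) := T.distrib f p l r q h.isExponential a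

theorem sum_ext {X Y : FinGSet G} {a b : T.obj (sum X Y)}
    (hl : T.res (inl X Y) a = T.res (inl X Y) b) (hr : T.res (inr X Y) a = T.res (inr X Y) b) :
    a = b := SemiMackey.sum_ext (M := T.additivePart) hl hr

/-- The element of `T(X ⊔ Y)` with given components in `T(X)` and `T(Y)`. -/
noncomputable def pair {X Y : FinGSet G} (a : T.obj X) (b : T.obj Y) : T.obj (sum X Y) :=
  SemiMackey.pair (M := T.additivePart) a b

@[simp] theorem res_inl_pair {X Y : FinGSet G} (a : T.obj X) (b : T.obj Y) :
    T.res (inl X Y) (pair a b) = a := SemiMackey.res_inl_pair (M := T.additivePart) a b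

@[simp] theorem res_inr_pair {X Y : FinGSet G} (a : T.obj X) (b : T.obj Y) :
    T.res (inr X Y) (pair a b) = b := SemiMackey.res_inr_pair (M := T.additivePart) a b

theorem res_sumMap {X Y X' Y' : FinGSet G} (f : X →[G] X') (g : Y →[G] Y') (a : T.obj X')
    (b : T.obj Y') : T.res (sumMap f g) (pair a b) = pair (T.res f a) (T.res g b) :=
  SemiMackey.res_sumMap (M := T.additivePart) f g a b

theorem res_copair {X Y Z : FinGSet G} (f : X →[G] Z) (g : Y →[G] Z) (c : T.obj Z) :
    T.res (copair f g) c = pair (T.res f c) (T.res g c) :=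
  SemiMackey.res_copair (M := T.additivePart) f g c

theorem tr_sumMap {X Y X' Y' : FinGSet G} (f : X →[G] X') (g : Y →[G] Y') (a : T.obj X)
    (b : T.obj Y) : T.tr (sumMap f g) (pair a b) = pair (T.tr f a) (T.tr g b) :=
  SemiMackey.tr_sumMap (M := T.additivePart) f g a b

theorem pair_res_left {X X' Y : FinGSet G} (f : X →[G] X') (a : T.obj X') (b : T.obj Y) :
    pair (T.res f a) b = T.res (sumMap f (idHom Y)) (pair a b) := by rw [res_sumMap, res_id]

theorem pair_res_right {X Y Y' : FinGSet G} (g : Y →[G] Y') (a : T.obj X) (b : T.obj Y') :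
    pair a (T.res g b) = T.res (sumMap (idHom X) g) (pair a b) := by rw [res_sumMap, res_id]

theorem pair_tr_left {X X' Y : FinGSet G} (f : X →[G] X') (a : T.obj X) (b : T.obj Y) :
    pair (T.tr f a) b = T.tr (sumMap f (idHom Y)) (pair a b) := by rw [tr_sumMap, tr_id]

theorem pair_tr_right {X Y Y' : FinGSet G} (g : Y →[G] Y') (a : T.obj X) (b : T.obj Y) :
    pair a (T.tr g b) = T.tr (sumMap (idHom X) g) (pair a b) := by rw [tr_sumMap, tr_id]

theorem add_def {X : FinGSet G} (a b : T.obj X) : a + b = T.tr (fold X) (pair a b) := rfl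

theorem mul_def {X : FinGSet G} (a b : T.obj X) : a * b = T.nm (fold X) (pair a b) := rfl

theorem zero_eq {E X : FinGSet G} [IsEmpty E] (f : E →[G] X) (c : T.obj E) : T.tr f c = 0 :=
  SemiMackey.one_eq (M := T.additivePart) f c

theorem one_eq {E X : FinGSet G} [IsEmpty E] (f : E →[G] X) (c : T.obj E) : T.nm f c = 1 :=
  SemiMackey.one_eq (M := T.multiplicativePart) f c

theorem res_mul {X Y : FinGSet G} (f : X →[G] Y) (a b : T.obj Y) :
    T.res f (a * b) = T.res f a * T.res f b := SemiMackey.res_mul (M := T.multiplicativePart) f a b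

theorem res_one {X Y : FinGSet G} (f : X →[G] Y) : T.res f 1 = 1 :=
  SemiMackey.res_one (M := T.multiplicativePart) f

theorem nm_mul {X Y : FinGSet G} (f : X →[G] Y) (a b : T.obj X) :
    T.nm f (a * b) = T.nm f a * T.nm f b := SemiMackey.tr_mul (M := T.multiplicativePart) f a b

theorem nm_one {X Y : FinGSet G} (f : X →[G] Y) : T.nm f 1 = 1 :=
  SemiMackey.tr_one (M := T.multiplicativePart) f

theorem res_add {X Y : FinGSet G} (f : X →[G] Y) (a b : T.obj Y) :
    T.res f (a + b) = T.res f a + T.res f b := SemiMackey.res_mul (M := T.additivePart) f a b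

theorem tr_add {X Y : FinGSet G} (f : X →[G] Y) (a b : T.obj X) :
    T.tr f (a + b) = T.tr f a + T.tr f b := SemiMackey.tr_mul (M := T.additivePart) f a b

theorem res_zero {X Y : FinGSet G} (f : X →[G] Y) : T.res f 0 = 0 :=
  SemiMackey.res_one (M := T.additivePart) f

theorem tr_zero {X Y : FinGSet G} (f : X →[G] Y) : T.tr f 0 = 0 :=
  SemiMackey.tr_one (M := T.additivePart) f

theorem res_inl_tr_inr {X Y : FinGSet G} (b : T.obj Y) : T.res (inl X Y) (T.tr (inr X Y) b) = 0 := by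
  have h : IsPB (elim (FinGSet.empty G) Y) (elim (FinGSet.empty G) X) (inr X Y) (inl X Y) :=
    .mk' (fun z => isEmptyElim z) (fun _ _ e => absurd e (inr_ne_inl _ _))
      (fun z => isEmptyElim z)
  rw [← mackey_tr h, zero_eq]

theorem res_inr_tr_inl {X Y : FinGSet G} (a : T.obj X) : T.res (inr X Y) (T.tr (inl X Y) a) = 0 := by
  have h : IsPB (elim (FinGSet.empty G) X) (elim (FinGSet.empty G) Y) (inl X Y) (inr X Y) :=
    .mk' (fun z => isEmptyElim z) (fun _ _ e => absurd e (inl_ne_inr _ _))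
      (fun z => isEmptyElim z)
  rw [← mackey_tr h, zero_eq]

theorem pair_eq_add {X Y : FinGSet G} (a : T.obj X) (b : T.obj Y) :
    pair a b = T.tr (inl X Y) a + T.tr (inr X Y) b := by
  have hl : T.res (inl X Y) (T.tr (inl X Y) a) = a :=
    SemiMackey.res_tr_of_injective (M := T.additivePart) inl_injective a
  have hr : T.res (inr X Y) (T.tr (inr X Y) b) = b :=
    SemiMackey.res_tr_of_injective (M := T.additivePart) inr_injective b
  apply sum_ext
  · rw [res_inl_pair, res_add, hl, res_inl_tr_inr, add_zero]
  · rw [res_inr_pair, res_add, hr, res_inr_tr_inl, zero_add]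

theorem isExp_fold {A A' : FinGSet G} (a : A →[G] A') :
    IsExp (fold A') (sumMap (idHom A') a) (sumMap a (idHom A)) (fold A) a where
  isPB := .mk' (by rintro (z | z) <;> rfl)
    (by
      rintro b (x | x) e
      · exact ⟨inl A A b, rfl, congrArg (inl A' A') e⟩
      · exact ⟨inr A A b, rfl, congrArg (inr A' A') e⟩)
    (by
      rintro (z | z) (z' | z') h h'
      · exact congrArg (inl A A) h
      · cases h'
      · cases h'
      · exact congrArg (inr A A) h)
  ex s := by
    have h := s.sec_spec ⟨inr A' A' s.pt, rfl⟩
    obtain ⟨b, hb⟩ : ∃ b, s.sec ⟨inr A' A' s.pt, rfl⟩ = inr A' A b := by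
      rcases sum_cases (s.sec ⟨inr A' A' s.pt, rfl⟩) with ⟨x, hx⟩ | ⟨x, hx⟩
      · rw [hx] at h; exact absurd h (inl_ne_inr _ _)
      · exact ⟨x, hx⟩
    rw [hb] at h
    have h' : a b = s.pt := inr_injective h
    refine ⟨b, h', ?_⟩
    rintro (z | z) hz e
    · have h₂ := s.sec_spec ⟨inl A' A' (a z), hz⟩
      rcases sum_cases (s.sec ⟨inl A' A' (a z), hz⟩) with ⟨x, hx⟩ | ⟨x, hx⟩
      · rw [hx] at h₂
        exact (congrArg (inl A' A) (inl_injective h₂).symm).trans hx.symm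
      · rw [hx] at h₂; exact absurd h₂ (inr_ne_inl _ _)
    · obtain rfl : z = b := e
      exact hb.symm.trans (s.sec_congr _ (congrArg (inr A' A') h'.symm))
  un b b' e h := inr_injective (h (inr A A b) (inr A A b') rfl rfl (congrArg (inr A' A') e))

/-- Frobenius reciprocity. -/
theorem mul_tr {A A' : FinGSet G} (a : A →[G] A') (x : T.obj A') (y : T.obj A) :
    x * T.tr a y = T.tr a (T.res a x * y) := by
  have h := tr_sumMap (T := T) (idHom A') a x y
  rw [tr_id] at h
  rw [mul_def, ← h, distrib' (isExp_fold a), res_sumMap, res_id, mul_def]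

theorem tr_mul_right {A A' : FinGSet G} (a : A →[G] A') (x : T.obj A') (y : T.obj A) :
    T.tr a y * x = T.tr a (y * T.res a x) := by rw [mul_comm, mul_tr, mul_comm]

end

/-- A morphism of (semi-)Tambara functors: a family of maps compatible with restrictions and both
kinds of transfers. It automatically consists of homomorphisms of semi-rings, since the operations
on `T(X)` are defined by restrictions and transfers (see `Hom.map_add`, `Hom.map_mul`,
`Hom.map_zero`, `Hom.map_one`). -/
@[ext] structure Hom (T : SemiTambara.{u, w} G) (S : SemiTambara.{u, w'} G) where
  app : ∀ X : FinGSet G, T.obj X → S.obj X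
  map_res : ∀ {X Y : FinGSet G} (f : X →[G] Y) (a : T.obj Y), app X (T.res f a) = S.res f (app Y a)
  map_tr : ∀ {X Y : FinGSet G} (f : X →[G] Y) (a : T.obj X), app Y (T.tr f a) = S.tr f (app X a)
  map_nm : ∀ {X Y : FinGSet G} (f : X →[G] Y) (a : T.obj X), app Y (T.nm f a) = S.nm f (app X a)

namespace Hom

variable {T : SemiTambara.{u, w} G} {S : SemiTambara.{u, w'} G} {U : SemiTambara.{u, w''} G}

/-- The identity morphism. -/
def id (T : SemiTambara.{u, w} G) : Hom T T := ⟨fun _ a => a, fun _ _ => rfl, fun _ _ => rfl, fun _ _ => rfl⟩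

/-- The composite `ψ ∘ φ`. -/
def comp (ψ : Hom S U) (φ : Hom T S) : Hom T U where
  app X a := ψ.app X (φ.app X a)
  map_res f a := by rw [φ.map_res, ψ.map_res]
  map_tr f a := by rw [φ.map_tr, ψ.map_tr]
  map_nm f a := by rw [φ.map_nm, ψ.map_nm]

theorem map_pair (φ : Hom T S) {X Y : FinGSet G} (a : T.obj X) (b : T.obj Y) :
    φ.app _ (pair a b) = pair (φ.app _ a) (φ.app _ b) :=
  sum_ext (by rw [← map_res, res_inl_pair, res_inl_pair])
    (by rw [← map_res, res_inr_pair, res_inr_pair])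

theorem map_add (φ : Hom T S) {X : FinGSet G} (a b : T.obj X) :
    φ.app X (a + b) = φ.app X a + φ.app X b := by
  rw [add_def, map_tr, map_pair, add_def]

theorem map_mul (φ : Hom T S) {X : FinGSet G} (a b : T.obj X) :
    φ.app X (a * b) = φ.app X a * φ.app X b := by
  rw [mul_def, map_nm, map_pair, mul_def]

theorem map_zero (φ : Hom T S) {X : FinGSet G} : φ.app X 0 = 0 := by
  obtain ⟨c, -⟩ : ∃ _ : T.obj (FinGSet.empty G), True := ⟨T.additivePart.emptyElt _, trivial⟩
  have h := zero_eq (elim (FinGSet.empty G) X) c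
  rw [← h, map_tr, zero_eq]

theorem map_one (φ : Hom T S) {X : FinGSet G} : φ.app X 1 = 1 := by
  obtain ⟨c, -⟩ : ∃ _ : T.obj (FinGSet.empty G), True := ⟨T.additivePart.emptyElt _, trivial⟩
  have h := one_eq (elim (FinGSet.empty G) X) c
  rw [← h, map_nm, one_eq]

end Hom

end SemiTambara

/-- The product of two semi-Mackey functors. -/
def SemiMackey.prod (M : SemiMackey.{u, w} G) (N : SemiMackey.{u, w'} G) :
    SemiMackey.{u, max w w'} G where
  obj X := M.obj X × N.obj X
  res f a := (M.res f a.1, N.res f a.2)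
  tr f a := (M.tr f a.1, N.tr f a.2)
  isSemiMackey :=
    { res_id := fun _ => Prod.ext (SemiMackey.res_id _) (SemiMackey.res_id _)
      res_comp := fun f g _ => Prod.ext (SemiMackey.res_comp f g _) (SemiMackey.res_comp f g _)
      tr_id := fun _ => Prod.ext (SemiMackey.tr_id _) (SemiMackey.tr_id _)
      tr_comp := fun f g _ => Prod.ext (SemiMackey.tr_comp f g _) (SemiMackey.tr_comp f g _)
      bijective_sum := fun X Y => by
        constructor
        · intro a b h
          simp only [Prod.mk.injEq] at h
          exact Prod.ext (SemiMackey.sum_ext h.1.1 h.2.1) (SemiMackey.sum_ext h.1.2 h.2.2)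
        · intro c
          refine ⟨(SemiMackey.pair c.1.1 c.2.1, SemiMackey.pair c.1.2 c.2.2), ?_⟩
          simp
      existsUnique_empty := fun X h => ⟨(M.emptyElt X, N.emptyElt X), trivial, fun _ _ =>
        Prod.ext (SemiMackey.empty_ext h _ _) (SemiMackey.empty_ext h _ _)⟩
      mackey := fun _ _ _ _ h _ => Prod.ext (SemiMackey.mackey h _) (SemiMackey.mackey h _) }

theorem SemiMackey.prod_pair {M : SemiMackey.{u, w} G} {N : SemiMackey.{u, w'} G} {X Y : FinGSet G}
    (a : M.obj X) (b : N.obj X) (c : M.obj Y) (d : N.obj Y) :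
    SemiMackey.pair (M := M.prod N) (X := X) (Y := Y) (a, b) (c, d)
      = (SemiMackey.pair a c, SemiMackey.pair b d) :=
  SemiMackey.sum_ext (M := M.prod N)
    ((SemiMackey.res_inl_pair (M := M.prod N) _ _).trans
      (Prod.ext (SemiMackey.res_inl_pair _ _).symm (SemiMackey.res_inl_pair _ _).symm))
    ((SemiMackey.res_inr_pair (M := M.prod N) _ _).trans
      (Prod.ext (SemiMackey.res_inr_pair _ _).symm (SemiMackey.res_inr_pair _ _).symm))

namespace Tambara

section

variable (T : Tambara.{u, w} G) (S : Tambara.{u, w'} G)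

/-- Symbols `s ⊗ t` in the component `p : A → X` of `(T ⊗ S)(X)`, with `s ∈ T(A)`, `t ∈ S(A)`. -/
abbrev TensorSymbol (X : FinGSet G) :=
  GSymbol (T.multiplicativePart.prod S.multiplicativePart) X

variable {T S} in
/-- The symbol `s ⊗ t` in the component `p : A → X`. -/
def tensorSymbol {X A : FinGSet G} (p : A →[G] X) (s : T.obj A) (t : S.obj A) :
    TensorSymbol T S X := ⟨A, p, (s, t)⟩

/-- The defining relations of the tensor product over the Burnside ring functor, for a map
`a : A → A'` over `X`. -/
inductive TensorRel {X : FinGSet G} : TensorSymbol T S X → TensorSymbol T S X → Prop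
  | left {A A' : FinGSet G} (a : A →[G] A') (p : A' →[G] X) (s' : T.obj A') (t : S.obj A) :
      TensorRel (tensorSymbol (comp p a) (T.res a s') t) (tensorSymbol p s' (S.tr a t))
  | right {A A' : FinGSet G} (a : A →[G] A') (p : A' →[G] X) (s : T.obj A) (t' : S.obj A') :
      TensorRel (tensorSymbol (comp p a) s (S.res a t')) (tensorSymbol p (T.tr a s) t')

variable {T S}

theorem tensorRel_left {X A A' : FinGSet G} (a : A →[G] A') {p : A' →[G] X} {q : A →[G] X}
    (hq : ∀ z, q z = p (a z)) {s : T.obj A} {s' : T.obj A'} (hs : s = T.res a s') (t : S.obj A)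
    {t' : S.obj A'} (ht : t' = S.tr a t) :
    Quot.mk (TensorRel T S) (tensorSymbol q s t) = Quot.mk _ (tensorSymbol p s' t') := by
  obtain rfl : q = comp p a := homExt hq
  subst hs ht
  exact Quot.sound (.left a p s' t)

theorem tensorRel_right {X A A' : FinGSet G} (a : A →[G] A') {p : A' →[G] X} {q : A →[G] X}
    (hq : ∀ z, q z = p (a z)) (s : T.obj A) {s' : T.obj A'} (hs : s' = T.tr a s) {t : S.obj A}
    {t' : S.obj A'} (ht : t = S.res a t') :
    Quot.mk (TensorRel T S) (tensorSymbol q s t) = Quot.mk _ (tensorSymbol p s' t') := by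
  obtain rfl : q = comp p a := homExt hq
  subst hs ht
  exact Quot.sound (.right a p s t')

end

/-- The transfer of an element along `a : C → A`, followed by the operation
`M_*(f') M^*(e)` on `Π_f(A)`. -/
theorem nm_res_tr (T : SemiTambara.{u, w} G) {X Y A C : FinGSet G} (f : X →[G] Y) (p : A →[G] X)
    (k : C →[G] A) (c : T.obj C) : T.nm (piMap f p) (T.res (piEval f p) (T.tr k c))
      = T.tr (piPost f p k) (T.nm (piMap f (comp p k)) (T.res (piEval f (comp p k)) c)) := by
  have hP := isPB_pb k (piEval f p)
  have e : ∀ z, k (piEval f (comp p k) z) = piEval f p (piTotPost f p k z) :=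
    fun z => (piEval_post z).symm
  have h := isExp_post hP (hP.lift_fst _ _ e) (hP.lift_snd _ _ e)
  rw [← SemiTambara.mackey_tr hP, SemiTambara.distrib' h,
    SemiTambara.res_res (fun z => (hP.lift_fst _ _ e z).symm)]

theorem nm_res_res (T : SemiTambara.{u, w} G) {X Y A C : FinGSet G} (f : X →[G] Y) (p : A →[G] X)
    (k : C →[G] A) (c : T.obj A) :
    T.nm (piMap f (comp p k)) (T.res (piEval f (comp p k)) (T.res k c))
      = T.res (piPost f p k) (T.nm (piMap f p) (T.res (piEval f p) c)) := by
  rw [← SemiTambara.mackey_nm isPB_piTotPost,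
    SemiTambara.res_sq (f := piTotPost f p k) (f' := piEval f (comp p k)) (g' := k) (fun _ => rfl)]

/-- The map on fibre products induced by a map `a : A → A'` over `Y`. -/
def pbPost {A A' X Y : FinGSet G} (a : A →[G] A') (p : A' →[G] Y) (f : X →[G] Y) :
    pb (comp p a) f →[G] pb p f :=
  mkHom (fun z => pbMk (a (pbFst (comp p a) f z)) (pbSnd (comp p a) f z) z.2)
    (fun g _ => pbExt (map_act a g _) rfl)

theorem isPB_pbPost {A A' X Y : FinGSet G} (a : A →[G] A') (p : A' →[G] Y) (f : X →[G] Y) :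
    IsPB (pbFst (comp p a) f) (pbPost a p f) a (pbFst p f) :=
  .mk' (fun _ => rfl)
    (fun a₀ z e => ⟨pbMk a₀ (pbSnd p f z) ((congrArg p e).trans (pb_comm p f z)), rfl,
      pbExt e rfl⟩)
    (fun _ _ h h' => pbExt h (congrArg (pbSnd p f) h'))

theorem tensorSymbol_sum {T : Tambara.{u, w} G} {S : Tambara.{u, w'} G} {X Y A B : FinGSet G}
    (p : A →[G] X) (s : T.obj A) (t : S.obj A) (q : B →[G] Y) (m : T.obj B) (n : S.obj B) :
    (tensorSymbol p s t).sum (tensorSymbol q m n)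
      = tensorSymbol (sumMap p q) (SemiTambara.pair s m) (SemiTambara.pair t n) := by
  unfold GSymbol.sum
  exact congrArg (GSymbol.mk _ _) (SemiMackey.prod_pair (M := T.multiplicativePart)
    (N := S.multiplicativePart) s t m n)

/-- Isomorphisms of symbols and the defining relations of the tensor product. -/
noncomputable def tensorSymRel (T : Tambara.{u, w} G) (S : Tambara.{u, w'} G) :
    SymRel (T.multiplicativePart.prod S.multiplicativePart) where
  rel := TensorRel T S
  iso := by
    rintro X ⟨A, p, s, t⟩ ⟨A', p', s', t'⟩ ⟨a, ha, hp, hm⟩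
    have hs : s = T.res a s' := congrArg Prod.fst hm
    have ht : t = S.res a t' := congrArg Prod.snd hm
    refine tensorRel_left a (fun z => (hp z).symm) hs t ?_
    rw [ht]
    exact (SemiMackey.tr_res_of_bijective (M := S.additivePart) ha t').symm
  res := by
    rintro X Y f _ _ (⟨a, p, s', t⟩ | ⟨a, p, s, t'⟩)
    · exact tensorRel_left (pbPost a p f) (fun _ => rfl)
        (SemiTambara.res_sq (T := T.toSemiTambara) (f := pbFst (comp p a) f) (g := a)
          (f' := pbPost a p f) (g' := pbFst p f) (fun _ => rfl) s') _
        (SemiTambara.mackey_tr (isPB_pbPost a p f) _).symm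
    · exact tensorRel_right (pbPost a p f) (fun _ => rfl) _
        (SemiTambara.mackey_tr (isPB_pbPost a p f) _).symm
        (SemiTambara.res_sq (T := S.toSemiTambara) (f := pbFst (comp p a) f) (g := a)
          (f' := pbPost a p f) (g' := pbFst p f) (fun _ => rfl) t')
  tr := by
    rintro X Y f _ _ (⟨a, p, s', t⟩ | ⟨a, p, s, t'⟩)
    · exact tensorRel_left a (fun _ => rfl) rfl _ rfl
    · exact tensorRel_right a (fun _ => rfl) _ rfl rfl
  nm := by
    rintro X Y f _ _ (⟨a, p, s', t⟩ | ⟨a, p, s, t'⟩)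
    · exact tensorRel_left (piPost f p a) (fun _ => rfl) (nm_res_res T.toSemiTambara f p a s') _
        (nm_res_tr S.toSemiTambara f p a t)
    · exact tensorRel_right (piPost f p a) (fun _ => rfl) _ (nm_res_tr T.toSemiTambara f p a s)
        (nm_res_res S.toSemiTambara f p a t')
  sum_left := by
    rintro X Y _ _ ⟨B, q, m, n⟩ (⟨a, p, s', t⟩ | ⟨a, p, s, t'⟩)
    · refine (congrArg _ (tensorSymbol_sum _ _ _ _ _ _)).trans (Eq.trans ?_
        (congrArg _ (tensorSymbol_sum _ _ _ _ _ _).symm))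
      refine tensorRel_left (sumMap a (idHom B)) (by rintro (z | z) <;> rfl) (SemiTambara.pair_res_left _ _ _) _
        (SemiTambara.pair_tr_left _ _ _)
    · refine (congrArg _ (tensorSymbol_sum _ _ _ _ _ _)).trans (Eq.trans ?_
        (congrArg _ (tensorSymbol_sum _ _ _ _ _ _).symm))
      refine tensorRel_right (sumMap a (idHom B)) (by rintro (z | z) <;> rfl) _ (SemiTambara.pair_tr_left _ _ _)
        (SemiTambara.pair_res_left _ _ _)
  sum_right := by
    rintro X Y ⟨B, q, m, n⟩ _ _ (⟨a, p, s', t⟩ | ⟨a, p, s, t'⟩)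
    · refine (congrArg _ (tensorSymbol_sum _ _ _ _ _ _)).trans (Eq.trans ?_
        (congrArg _ (tensorSymbol_sum _ _ _ _ _ _).symm))
      refine tensorRel_left (sumMap (idHom B) a) (by rintro (z | z) <;> rfl) (SemiTambara.pair_res_right _ _ _) _
        (SemiTambara.pair_tr_right _ _ _)
    · refine (congrArg _ (tensorSymbol_sum _ _ _ _ _ _)).trans (Eq.trans ?_
        (congrArg _ (tensorSymbol_sum _ _ _ _ _ _).symm))
      refine tensorRel_right (sumMap (idHom B) a) (by rintro (z | z) <;> rfl) _ (SemiTambara.pair_tr_right _ _ _)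
        (SemiTambara.pair_res_right _ _ _)

end Tambara

end

section

variable {G : Type u} [Group G]

open FinGSet

namespace Tambara

theorem exists_neg (T : Tambara.{u, w} G) {X : FinGSet G} (a : T.obj X) : ∃ b, a + b = 0 :=
  T.isMackey X a

section

variable (T : Tambara.{u, w} G) (S : Tambara.{u, w'} G)

/-- The semi-Tambara functor underlying `T ⊗ S`. -/
noncomputable def semiTensor : SemiTambara.{u, max (u+1) w w'} G := (tensorSymRel T S).semiTambara

variable {T S}

/-- The class `[s ⊗ t]_{(A, p)}` in `(T ⊗ S)(X)` of the symbol `s ⊗ t` in the component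
`p : A → X`. -/
noncomputable def tmul {X A : FinGSet G} (p : A →[G] X) (s : T.obj A) (t : S.obj A) : (semiTensor T S).obj X :=
  (tensorSymRel T S).cls (tensorSymbol p s t)

theorem exists_tmul {X : FinGSet G} (c : (semiTensor T S).obj X) :
    ∃ (A : FinGSet G) (p : A →[G] X) (s : T.obj A) (t : S.obj A), tmul p s t = c := by
  obtain ⟨⟨A, p, s, t⟩, rfl⟩ := SymRel.cls_surj c
  exact ⟨A, p, s, t, rfl⟩

theorem tmul_left {X A A' : FinGSet G} (a : A →[G] A') {p : A' →[G] X} {q : A →[G] X}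
    (hq : ∀ z, q z = p (a z)) (s' : T.obj A') (t : S.obj A) :
    tmul q (T.res a s') t = tmul p s' (S.tr a t) := tensorRel_left a hq rfl t rfl

theorem tmul_right {X A A' : FinGSet G} (a : A →[G] A') {p : A' →[G] X} {q : A →[G] X}
    (hq : ∀ z, q z = p (a z)) (s : T.obj A) (t' : S.obj A') :
    tmul q s (S.res a t') = tmul p (T.tr a s) t' := tensorRel_right a hq s rfl rfl

theorem res_tmul {X Y A P : FinGSet G} {f : X →[G] Y} {p : A →[G] Y} {a : P →[G] A} {x : P →[G] X}
    (h : IsPB a x p f) (s : T.obj A) (t : S.obj A) :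
    (semiTensor T S).res f (tmul p s t) = tmul x (T.res a s) (S.res a t) :=
  SymRel.resQ_mk (R := tensorSymRel T S) f (s, t) h

theorem tr_tmul {X Y A : FinGSet G} (f : X →[G] Y) (p : A →[G] X) (s : T.obj A) (t : S.obj A) :
    (semiTensor T S).tr f (tmul p s t) = tmul (comp f p) s t := rfl

theorem nm_tmul {X Y A Z B : FinGSet G} {f : X →[G] Y} {p : A →[G] X} {l : Z →[G] A}
    {r : Z →[G] B} {q : B →[G] Y} (h : IsExp f p l r q) (s : T.obj A) (t : S.obj A) :
    (semiTensor T S).nm f (tmul p s t) = tmul q (T.nm r (T.res l s)) (S.nm r (S.res l t)) :=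
  SymRel.nmQ_mk (R := tensorSymRel T S) h (s, t)

theorem pair_tmul {X Y A B : FinGSet G} (p : A →[G] X) (s : T.obj A) (t : S.obj A) (q : B →[G] Y)
    (m : T.obj B) (n : S.obj B) : SemiTambara.pair (T := semiTensor T S) (tmul p s t) (tmul q m n)
      = tmul (sumMap p q) (SemiTambara.pair s m) (SemiTambara.pair t n) := by
  refine SemiTambara.sum_ext ?_ ?_
  · rw [SemiTambara.res_inl_pair, res_tmul (SemiMackey.isPB_inl p q), SemiTambara.res_inl_pair,
      SemiTambara.res_inl_pair]
  · rw [SemiTambara.res_inr_pair, res_tmul (SemiMackey.isPB_inr p q), SemiTambara.res_inr_pair,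
      SemiTambara.res_inr_pair]

theorem tmul_add_tmul {X A B : FinGSet G} (p : A →[G] X) (s : T.obj A) (t : S.obj A) (q : B →[G] X)
    (m : T.obj B) (n : S.obj B) : tmul p s t + tmul q m n
      = tmul (copair p q) (SemiTambara.pair s m) (SemiTambara.pair t n) := by
  have e : comp (fold X) (sumMap p q) = copair p q := homExt (by rintro (z | z) <;> rfl)
  rw [SemiTambara.add_def, pair_tmul, tr_tmul, e]

theorem tmul_add {X A : FinGSet G} (p : A →[G] X) (s : T.obj A) (t t' : S.obj A) :
    tmul p s (t + t') = tmul p s t + tmul p s t' := by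
  rw [tmul_add_tmul, SemiTambara.add_def, ← tmul_left (q := copair p p) (fold A)
    (by rintro (z | z) <;> rfl)]
  congr 1
  exact (SemiTambara.res_copair _ _ _).trans (by rw [SemiTambara.res_id])

theorem add_tmul {X A : FinGSet G} (p : A →[G] X) (s s' : T.obj A) (t : S.obj A) :
    tmul p (s + s') t = tmul p s t + tmul p s' t := by
  rw [tmul_add_tmul, SemiTambara.add_def, ← tmul_right (q := copair p p) (fold A)
    (by rintro (z | z) <;> rfl)]
  congr 1
  exact (SemiTambara.res_copair _ _ _).trans (by rw [SemiTambara.res_id])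

theorem tmul_zero {X A : FinGSet G} (p : A →[G] X) (s : T.obj A) :
    tmul p s (0 : S.obj A) = 0 := by
  obtain ⟨c, -⟩ : ∃ _ : S.obj (FinGSet.empty G), True := ⟨S.additivePart.emptyElt _, trivial⟩
  rw [← SemiTambara.zero_eq (elim (FinGSet.empty G) A) c, ← tmul_left (q := elim _ X)
    (elim (FinGSet.empty G) A) (fun z => isEmptyElim z)]
  have h := tr_tmul (T := T) (S := S) (elim (FinGSet.empty G) X) (idHom _)
    (T.res (elim (FinGSet.empty G) A) s) c
  rw [SemiTambara.zero_eq] at h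
  rw [h]
  congr 1

end

/-- The tensor product `T ⊗_Ω S` of two Tambara functors. An element of `(T ⊗ S)(X)` is a class
`[s ⊗ t]_{(A, p)}` with `p : A → X`, `s ∈ T(A)`, `t ∈ S(A)`, subject to the relations
`[a^* s' ⊗ t]_{(A, p a)} = [s' ⊗ a_+ t]_{(A', p)}` and
`[s ⊗ a^* t']_{(A, p a)} = [a_+ s ⊗ t']_{(A', p)}` for maps `a : A → A'`. Sums are given by disjoint
unions (`tmul_add_tmul`); the classes are biadditive (`tmul_add`, `add_tmul`), every element is of
this form, and `existsUnique_tensorLift` shows that the group `(T ⊗ S)(X)` is the quotient of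
`⨁_{A → X} T(A) ⊗_ℤ S(A)` by the above relations. -/
noncomputable def tensor (T : Tambara.{u, w} G) (S : Tambara.{u, w'} G) :
    Tambara.{u, max (u+1) w w'} G where
  toSemiTambara := semiTensor T S
  isMackey := by
    intro X c
    obtain ⟨A, p, s, t, rfl⟩ := exists_tmul c
    obtain ⟨t', ht⟩ := S.exists_neg t
    refine ⟨tmul p s t', ?_⟩
    change tmul p s t + tmul p s t' = 0
    rw [← tmul_add, ht, tmul_zero]

/-- The universal property of `(T ⊗ S)(X)` as the abelian group generated by the classes
`[s ⊗ t]_{(A, p)}` subject to biadditivity and the two families of relations above. -/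
theorem existsUnique_tensorLift (T : Tambara.{u, w} G) (S : Tambara.{u, w'} G) (X : FinGSet G)
    {E : Type w''} [AddCommGroup E] (β : ∀ A : FinGSet G, (A →[G] X) → T.obj A → S.obj A → E)
    (add_left : ∀ A p s s' t, β A p (s + s') t = β A p s t + β A p s' t)
    (add_right : ∀ A p s t t', β A p s (t + t') = β A p s t + β A p s t')
    (left : ∀ (A A' : FinGSet G) (a : A →[G] A') (p : A' →[G] X) s' t,
      β A (comp p a) (T.res a s') t = β A' p s' (S.tr a t))
    (right : ∀ (A A' : FinGSet G) (a : A →[G] A') (p : A' →[G] X) s t',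
      β A (comp p a) s (S.res a t') = β A' p (T.tr a s) t') :
    ∃! F : (tensor T S).obj X →+ E, ∀ A p s t, F (tmul p s t) = β A p s t := by
  let F₀ : (tensor T S).obj X → E := Quot.lift (fun s => β s.base s.map s.val.1 s.val.2) (by
    rintro _ _ (⟨a, p, s', t⟩ | ⟨a, p, s, t'⟩)
    exacts [left _ _ _ _ _ _, right _ _ _ _ _ _])
  have h₀ : ∀ A p s t, F₀ (tmul (A := A) p s t) = β A p s t := fun _ _ _ _ => rfl
  have zero : ∀ A p s, β A p s 0 = 0 := fun A p s => by
    have := add_right A p s 0 0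
    rwa [add_zero, left_eq_add] at this
  have zero' : ∀ A p t, β A p 0 t = 0 := fun A p t => by
    have := add_left A p 0 0 t
    rwa [add_zero, left_eq_add] at this
  refine ⟨⟨⟨F₀, ?_⟩, ?_⟩, h₀, fun F hF => ?_⟩
  · have h := tmul_zero (T := T) (S := S) (idHom X) 0
    change F₀ 0 = 0
    rw [← show _ = (0 : (tensor T S).obj X) from h, h₀, zero]
  · intro c d
    obtain ⟨A, p, s, t, rfl⟩ := exists_tmul c
    obtain ⟨B, q, m, n, rfl⟩ := exists_tmul d
    refine (congrArg F₀ (tmul_add_tmul p s t q m n)).trans ?_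
    change β _ (copair p q) (SemiTambara.pair s m) (SemiTambara.pair t n) = β A p s t + β B q m n
    have e₂ : p = comp (copair p q) (inl A B) := homExt fun _ => rfl
    have e₃ : q = comp (copair p q) (inr A B) := homExt fun _ => rfl
    rw [SemiTambara.pair_eq_add t n, add_right, ← left, ← left, SemiTambara.res_inl_pair, SemiTambara.res_inr_pair, ← e₂,
      ← e₃]
  · ext c
    obtain ⟨A, p, s, t, rfl⟩ := exists_tmul c
    exact (hF A p s t).trans (h₀ A p s t).symm

section

variable (T : Tambara.{u, w} G) (S : Tambara.{u, w'} G)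

/-- The morphism `T → T ⊗ S`, `t ↦ [t ⊗ 1]_{(X, id)}`. -/
noncomputable def inlHom : SemiTambara.Hom T.toSemiTambara (tensor T S).toSemiTambara where
  app X s := tmul (idHom X) s 1
  map_res {X Y} f s := by
    have h : IsPB f (idHom X) (idHom Y) f :=
      .mk' (fun _ => rfl) (fun _ x e => ⟨x, e.symm, rfl⟩) (fun _ _ _ h => h)
    exact ((res_tmul h s 1).trans (by rw [SemiTambara.res_one])).symm
  map_tr {X Y} f s := by
    refine Eq.symm ((tr_tmul f (idHom X) s 1).trans ?_)
    rw [← tmul_right (q := comp f (idHom X)) f (fun _ => rfl), SemiTambara.res_one]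
  map_nm {X Y} f s := by
    refine Eq.symm ((nm_tmul (isExp_idSection f) s 1).trans ?_)
    rw [SemiTambara.res_id, SemiTambara.res_id, SemiTambara.nm_one]

/-- The morphism `S → T ⊗ S`, `s ↦ [1 ⊗ s]_{(X, id)}`. -/
noncomputable def inrHom : SemiTambara.Hom S.toSemiTambara (tensor T S).toSemiTambara where
  app X t := tmul (idHom X) 1 t
  map_res {X Y} f t := by
    have h : IsPB f (idHom X) (idHom Y) f :=
      .mk' (fun _ => rfl) (fun _ x e => ⟨x, e.symm, rfl⟩) (fun _ _ _ h => h)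
    exact ((res_tmul h 1 t).trans (by rw [SemiTambara.res_one])).symm
  map_tr {X Y} f t := by
    refine Eq.symm ((tr_tmul f (idHom X) 1 t).trans ?_)
    rw [← tmul_left (q := comp f (idHom X)) f (fun _ => rfl), SemiTambara.res_one]
  map_nm {X Y} f t := by
    refine Eq.symm ((nm_tmul (isExp_idSection f) 1 t).trans ?_)
    rw [SemiTambara.res_id, SemiTambara.res_id, SemiTambara.nm_one]

variable {T S} {U : Tambara.{u, w''} G}

/-- The morphism `T ⊗ S → U` induced by `φ : T → U` and `ψ : S → U`:
`[s ⊗ t]_{(A, p)} ↦ p_+(φ(s) ψ(t))`. -/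
noncomputable def descHom (φ : SemiTambara.Hom T.toSemiTambara U.toSemiTambara)
    (ψ : SemiTambara.Hom S.toSemiTambara U.toSemiTambara) :
    SemiTambara.Hom (tensor T S).toSemiTambara U.toSemiTambara where
  app X := Quot.lift (fun s => U.tr s.map (φ.app _ s.val.1 * ψ.app _ s.val.2)) (by
    rintro _ _ (⟨a, p, s', t⟩ | ⟨a, p, s, t'⟩)
    · change U.tr (comp p a) (φ.app _ (T.res a s') * ψ.app _ t)
        = U.tr p (φ.app _ s' * ψ.app _ (S.tr a t))
      rw [φ.map_res, ψ.map_tr, SemiTambara.mul_tr,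
        SemiTambara.tr_tr (h := comp p a) (fun _ => rfl)]
    · change U.tr (comp p a) (φ.app _ s * ψ.app _ (S.res a t'))
        = U.tr p (φ.app _ (T.tr a s) * ψ.app _ t')
      rw [ψ.map_res, φ.map_tr, SemiTambara.tr_mul_right,
        SemiTambara.tr_tr (h := comp p a) (fun _ => rfl)])
  map_res f c := by
    obtain ⟨A, p, s, t, rfl⟩ := exists_tmul c
    change U.tr (pbSnd p f) (φ.app _ (T.res (pbFst p f) s) * ψ.app _ (S.res (pbFst p f) t))
      = U.res f (U.tr p (φ.app _ s * ψ.app _ t))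
    rw [φ.map_res, ψ.map_res, ← SemiTambara.res_mul, SemiTambara.mackey_tr (isPB_pb p f)]
  map_tr f c := by
    obtain ⟨A, p, s, t, rfl⟩ := exists_tmul c
    exact (SemiTambara.tr_tr (T := U.toSemiTambara) (fun _ => rfl) _).symm
  map_nm f c := by
    obtain ⟨A, p, s, t, rfl⟩ := exists_tmul c
    change U.tr (piProj f p) (φ.app _ (T.nm (piMap f p) (T.res (piEval f p) s))
        * ψ.app _ (S.nm (piMap f p) (S.res (piEval f p) t)))
      = U.nm f (U.tr p (φ.app _ s * ψ.app _ t))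
    rw [φ.map_nm, φ.map_res, ψ.map_nm, ψ.map_res, ← SemiTambara.nm_mul, ← SemiTambara.res_mul,
      SemiTambara.distrib' (isExp_canonical f p)]

end

end Tambara

end

/-! ## The Burnside Tambara functor -/

section

variable {G : Type u} [Group G]

open FinGSet

/-- Formal expressions, without variables, in the operations of a Tambara functor on `G`. Here
`star` stands for the element of `Ω(∅)`, and `pair a b` for the element of `Ω(X ⊔ Y)` with
components `a` and `b`. -/
inductive BurnsideTerm (G : Type u) [Group G] : FinGSet G → Type (u + 1)
  | star : BurnsideTerm G (FinGSet.empty G)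
  | pair {X Y : FinGSet G} (a : BurnsideTerm G X) (b : BurnsideTerm G Y) : BurnsideTerm G (sum X Y)
  | neg {X : FinGSet G} (a : BurnsideTerm G X) : BurnsideTerm G X
  | res {X Y : FinGSet G} (f : X →[G] Y) (a : BurnsideTerm G Y) : BurnsideTerm G X
  | tr {X Y : FinGSet G} (f : X →[G] Y) (a : BurnsideTerm G X) : BurnsideTerm G Y
  | nm {X Y : FinGSet G} (f : X →[G] Y) (a : BurnsideTerm G X) : BurnsideTerm G Y

/-- The relations between formal expressions: the axioms of a Tambara functor, and compatibility
with the operations. -/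
inductive BurnsideRel {G : Type u} [Group G] :
    ∀ {X : FinGSet G}, BurnsideTerm G X → BurnsideTerm G X → Prop
  | congr_pair_left {X Y : FinGSet G} {a a' : BurnsideTerm G X} (b : BurnsideTerm G Y) :
      BurnsideRel a a' → BurnsideRel (.pair a b) (.pair a' b)
  | congr_pair_right {X Y : FinGSet G} (a : BurnsideTerm G X) {b b' : BurnsideTerm G Y} :
      BurnsideRel b b' → BurnsideRel (.pair a b) (.pair a b')
  | congr_neg {X : FinGSet G} {a a' : BurnsideTerm G X} :
      BurnsideRel a a' → BurnsideRel (.neg a) (.neg a')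
  | congr_res {X Y : FinGSet G} (f : X →[G] Y) {a a' : BurnsideTerm G Y} :
      BurnsideRel a a' → BurnsideRel (.res f a) (.res f a')
  | congr_tr {X Y : FinGSet G} (f : X →[G] Y) {a a' : BurnsideTerm G X} :
      BurnsideRel a a' → BurnsideRel (.tr f a) (.tr f a')
  | congr_nm {X Y : FinGSet G} (f : X →[G] Y) {a a' : BurnsideTerm G X} :
      BurnsideRel a a' → BurnsideRel (.nm f a) (.nm f a')
  | res_id {X : FinGSet G} (a : BurnsideTerm G X) : BurnsideRel (.res (idHom X) a) a
  | res_comp {X Y Z : FinGSet G} (f : X →[G] Y) (g : Y →[G] Z) (a : BurnsideTerm G Z) :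
      BurnsideRel (.res (comp g f) a) (.res f (.res g a))
  | tr_id {X : FinGSet G} (a : BurnsideTerm G X) : BurnsideRel (.tr (idHom X) a) a
  | tr_comp {X Y Z : FinGSet G} (f : X →[G] Y) (g : Y →[G] Z) (a : BurnsideTerm G X) :
      BurnsideRel (.tr (comp g f) a) (.tr g (.tr f a))
  | nm_id {X : FinGSet G} (a : BurnsideTerm G X) : BurnsideRel (.nm (idHom X) a) a
  | nm_comp {X Y Z : FinGSet G} (f : X →[G] Y) (g : Y →[G] Z) (a : BurnsideTerm G X) :
      BurnsideRel (.nm (comp g f) a) (.nm g (.nm f a))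
  | empty {X : FinGSet G} (h : IsEmpty X) (a b : BurnsideTerm G X) : BurnsideRel a b
  | res_inl_pair {X Y : FinGSet G} (a : BurnsideTerm G X) (b : BurnsideTerm G Y) :
      BurnsideRel (.res (inl X Y) (.pair a b)) a
  | res_inr_pair {X Y : FinGSet G} (a : BurnsideTerm G X) (b : BurnsideTerm G Y) :
      BurnsideRel (.res (inr X Y) (.pair a b)) b
  | pair_res {X Y : FinGSet G} (c : BurnsideTerm G (sum X Y)) :
      BurnsideRel (.pair (.res (inl X Y) c) (.res (inr X Y) c)) c
  | mackey_tr {X' Y' X Y : FinGSet G} (f' : X' →[G] Y') (x : X' →[G] X) (y : Y' →[G] Y)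
      (f : X →[G] Y) (h : IsPB f' x y f) (c : BurnsideTerm G Y') :
      BurnsideRel (.tr x (.res f' c)) (.res f (.tr y c))
  | mackey_nm {X' Y' X Y : FinGSet G} (f' : X' →[G] Y') (x : X' →[G] X) (y : Y' →[G] Y)
      (f : X →[G] Y) (h : IsPB f' x y f) (c : BurnsideTerm G Y') :
      BurnsideRel (.nm x (.res f' c)) (.res f (.nm y c))
  | distrib {X Y A Z B : FinGSet G} (f : X →[G] Y) (p : A →[G] X) (l : Z →[G] A) (r : Z →[G] B)
      (q : B →[G] Y) (h : IsExponential f p l r q) (a : BurnsideTerm G A) :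
      BurnsideRel (.nm f (.tr p a)) (.tr q (.nm r (.res l a)))
  | add_neg {X : FinGSet G} (a : BurnsideTerm G X) :
      BurnsideRel (.tr (fold X) (.pair a (.neg a))) (.tr (elim (FinGSet.empty G) X) .star)

namespace Tambara

/-- The underlying semi-Tambara functor of `Ω`. -/
def semiBurnside (G : Type u) [Group G] : SemiTambara.{u, u + 1} G where
  obj X := Quot (BurnsideRel (X := X))
  res f := Quot.map (.res f) fun _ _ => .congr_res f
  tr f := Quot.map (.tr f) fun _ _ => .congr_tr f
  nm f := Quot.map (.nm f) fun _ _ => .congr_nm f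
  isSemiMackey_tr :=
    { res_id := by rintro X ⟨a⟩; exact Quot.sound (.res_id a)
      res_comp := by rintro X Y Z f g ⟨a⟩; exact Quot.sound (.res_comp f g a)
      tr_id := by rintro X ⟨a⟩; exact Quot.sound (.tr_id a)
      tr_comp := by rintro X Y Z f g ⟨a⟩; exact Quot.sound (.tr_comp f g a)
      bijective_sum := fun X Y => by
        let P : Quot (BurnsideRel (X := X)) → Quot (BurnsideRel (X := Y)) →
            Quot (BurnsideRel (X := sum X Y)) :=
          Quot.map₂ .pair (fun a _ _ h => .congr_pair_right a h) (fun _ _ b h => .congr_pair_left b h)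
        refine Function.bijective_iff_has_inverse.2 ⟨fun c => P c.1 c.2, ?_, ?_⟩
        · rintro ⟨c⟩; exact Quot.sound (.pair_res c)
        · rintro ⟨⟨a⟩, ⟨b⟩⟩
          exact Prod.ext (Quot.sound (.res_inl_pair a b)) (Quot.sound (.res_inr_pair a b))
      existsUnique_empty := fun X h =>
        ⟨Quot.mk _ (.tr (elim (FinGSet.empty G) X) .star), trivial, by
          rintro ⟨a⟩ -; exact Quot.sound (.empty h _ _)⟩
      mackey := by rintro X' Y' X Y f' x y f h ⟨c⟩; exact Quot.sound (.mackey_tr f' x y f h c) }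
  isSemiMackey_nm :=
    { res_id := by rintro X ⟨a⟩; exact Quot.sound (.res_id a)
      res_comp := by rintro X Y Z f g ⟨a⟩; exact Quot.sound (.res_comp f g a)
      tr_id := by rintro X ⟨a⟩; exact Quot.sound (.nm_id a)
      tr_comp := by rintro X Y Z f g ⟨a⟩; exact Quot.sound (.nm_comp f g a)
      bijective_sum := fun X Y => by
        let P : Quot (BurnsideRel (X := X)) → Quot (BurnsideRel (X := Y)) →
            Quot (BurnsideRel (X := sum X Y)) :=
          Quot.map₂ .pair (fun a _ _ h => .congr_pair_right a h) (fun _ _ b h => .congr_pair_left b h)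
        refine Function.bijective_iff_has_inverse.2 ⟨fun c => P c.1 c.2, ?_, ?_⟩
        · rintro ⟨c⟩; exact Quot.sound (.pair_res c)
        · rintro ⟨⟨a⟩, ⟨b⟩⟩
          exact Prod.ext (Quot.sound (.res_inl_pair a b)) (Quot.sound (.res_inr_pair a b))
      existsUnique_empty := fun X h =>
        ⟨Quot.mk _ (.tr (elim (FinGSet.empty G) X) .star), trivial, by
          rintro ⟨a⟩ -; exact Quot.sound (.empty h _ _)⟩
      mackey := by rintro X' Y' X Y f' x y f h ⟨c⟩; exact Quot.sound (.mackey_nm f' x y f h c) }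
  distrib := by rintro X Y A Z B f p l r q h ⟨a⟩; exact Quot.sound (.distrib f p l r q h a)

/-- The class of a formal expression. -/
def burnsideMk {X : FinGSet G} (a : BurnsideTerm G X) : (semiBurnside G).obj X := Quot.mk _ a

theorem semiBurnside_pair {X Y : FinGSet G} (a : BurnsideTerm G X) (b : BurnsideTerm G Y) :
    SemiTambara.pair (burnsideMk a) (burnsideMk b) = burnsideMk (.pair a b) :=
  SemiTambara.sum_ext
    ((SemiTambara.res_inl_pair _ _).trans (Quot.sound (.res_inl_pair a b)).symm)
    ((SemiTambara.res_inr_pair _ _).trans (Quot.sound (.res_inr_pair a b)).symm)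

theorem semiBurnside_add_neg {X : FinGSet G} (a : BurnsideTerm G X) :
    burnsideMk a + burnsideMk (.neg a) = 0 := by
  rw [SemiTambara.add_def, semiBurnside_pair,
    ← SemiTambara.zero_eq (elim (FinGSet.empty G) X) (burnsideMk .star)]
  exact Quot.sound (.add_neg a)

/-- The Burnside ring functor `Ω` on `G`, constructed as the initial Tambara functor on `G`
(`burnsideHom`, `burnsideHom_unique`). The class in `Ω(X)` of a finite `G`-set `p : A → X` over `X`
is `p_+(1)`. -/
def burnside (G : Type u) [Group G] : Tambara.{u, u + 1} G where
  toSemiTambara := semiBurnside G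
  isMackey := by rintro X ⟨a⟩; exact ⟨burnsideMk (.neg a), semiBurnside_add_neg a⟩

/-- The value of a formal expression in a Tambara functor. -/
noncomputable def termValue (T : Tambara.{u, w} G) : ∀ {X : FinGSet G}, BurnsideTerm G X → T.obj X
  | _, .star => T.additivePart.emptyElt _
  | _, .pair a b => SemiTambara.pair (termValue T a) (termValue T b)
  | _, .neg a => (T.exists_neg (termValue T a)).choose
  | _, .res f a => T.res f (termValue T a)
  | _, .tr f a => T.tr f (termValue T a)
  | _, .nm f a => T.nm f (termValue T a)

theorem termValue_rel (T : Tambara.{u, w} G) {X : FinGSet G} {a b : BurnsideTerm G X}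
    (h : BurnsideRel a b) : termValue T a = termValue T b := by
  induction h with
  | congr_pair_left b _ ih => simp only [termValue, ih]
  | congr_pair_right a _ ih => simp only [termValue, ih]
  | congr_neg _ ih => simp only [termValue, ih]
  | congr_res f _ ih => simp only [termValue, ih]
  | congr_tr f _ ih => simp only [termValue, ih]
  | congr_nm f _ ih => simp only [termValue, ih]
  | res_id a => exact T.isSemiMackey_tr.res_id _
  | res_comp f g a => exact T.isSemiMackey_tr.res_comp _ _ _
  | tr_id a => exact T.isSemiMackey_tr.tr_id _
  | tr_comp f g a => exact T.isSemiMackey_tr.tr_comp _ _ _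
  | nm_id a => exact T.isSemiMackey_nm.tr_id _
  | nm_comp f g a => exact T.isSemiMackey_nm.tr_comp _ _ _
  | empty h a b => exact SemiMackey.empty_ext (M := T.additivePart) h _ _
  | res_inl_pair a b => exact SemiTambara.res_inl_pair _ _
  | res_inr_pair a b => exact SemiTambara.res_inr_pair _ _
  | pair_res c =>
    exact SemiTambara.sum_ext (SemiTambara.res_inl_pair _ _) (SemiTambara.res_inr_pair _ _)
  | mackey_tr f' x y f h c => exact T.isSemiMackey_tr.mackey _ _ _ _ h _
  | mackey_nm f' x y f h c => exact T.isSemiMackey_nm.mackey _ _ _ _ h _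
  | distrib f p l r q h a => exact T.distrib _ _ _ _ _ h _
  | add_neg a =>
    refine (T.exists_neg (termValue T a)).choose_spec.trans ?_
    exact (SemiTambara.zero_eq _ _).symm

/-- The unique morphism `Ω → T` to a Tambara functor `T`. -/
noncomputable def burnsideHom (T : Tambara.{u, w} G) :
    SemiTambara.Hom (burnside G).toSemiTambara T.toSemiTambara where
  app _ := Quot.lift (termValue T) fun _ _ => termValue_rel T
  map_res := by rintro X Y f ⟨a⟩; rfl
  map_tr := by rintro X Y f ⟨a⟩; rfl
  map_nm := by rintro X Y f ⟨a⟩; rfl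

/-- `Ω` is an initial Tambara functor. -/
theorem burnsideHom_unique (T : Tambara.{u, w} G)
    (φ : SemiTambara.Hom (burnside G).toSemiTambara T.toSemiTambara) : φ = burnsideHom T := by
  have key : ∀ {X : FinGSet G} (a : BurnsideTerm G X), φ.app X (burnsideMk a) = termValue T a := by
    intro X a
    induction a with
    | star => exact SemiMackey.empty_ext (M := T.additivePart) inferInstance _ _
    | pair a b iha ihb =>
      have h := φ.map_pair (burnsideMk a) (burnsideMk b)
      rw [iha, ihb] at h
      exact (congrArg _ (semiBurnside_pair a b).symm).trans h
    | neg a ih =>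
      have h₁ := (φ.map_add (burnsideMk a) (burnsideMk (.neg a))).symm.trans
        ((congrArg _ (semiBurnside_add_neg a)).trans φ.map_zero)
      rw [ih] at h₁
      have h₂ : termValue T a + termValue T (.neg a) = 0 := (T.exists_neg (termValue T a)).choose_spec
      exact left_neg_eq_right_neg ((add_comm _ _).trans h₁) h₂
    | res f a ih => exact (φ.map_res f _).trans (congrArg _ ih)
    | tr f a ih => exact (φ.map_tr f _).trans (congrArg _ ih)
    | nm f a ih => exact (φ.map_nm f _).trans (congrArg _ ih)
  refine SemiTambara.Hom.ext (funext fun X => funext ?_)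
  rintro ⟨a⟩
  exact key a

end Tambara

end

/-! ## Hopf Tambara functors and group-like elements -/

section

variable {G : Type u} [Group G]

open FinGSet

namespace Tambara

/-- A morphism of Tambara functors. -/
abbrev Hom (T : Tambara.{u, w} G) (S : Tambara.{u, w'} G) :=
  SemiTambara.Hom T.toSemiTambara S.toSemiTambara

/-- The identity morphism. -/
abbrev idMor (T : Tambara.{u, w} G) : Hom T T := SemiTambara.Hom.id T.toSemiTambara

theorem inl_mul_inr {T : Tambara.{u, w} G} {S : Tambara.{u, w'} G} {X : FinGSet G} (s : T.obj X)
    (t : S.obj X) : (inlHom T S).app X s * (inrHom T S).app X t = tmul (idHom X) s t := by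
  have h₁ := pair_tmul (T := T) (S := S) (idHom X) s 1 (idHom X) 1 t
  have h₂ : sumMap (idHom X) (idHom X) = idHom (sum X X) := homExt (by rintro (x | x) <;> rfl)
  rw [h₂] at h₁
  refine (congrArg ((tensor T S).nm (fold X)) h₁).trans ?_
  refine (nm_tmul (isExp_idSection (fold X)) _ _).trans ?_
  rw [SemiTambara.res_id, SemiTambara.res_id, ← SemiTambara.mul_def, ← SemiTambara.mul_def,
    mul_one, one_mul]

theorem descHom_tmul {T : Tambara.{u, w} G} {S : Tambara.{u, w'} G} {U : Tambara.{u, w''} G}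
    (φ : Hom T U) (ψ : Hom S U) {X A : FinGSet G} (p : A →[G] X) (s : T.obj A) (t : S.obj A) :
    (descHom φ ψ).app X (tmul p s t) = U.tr p (φ.app A s * ψ.app A t) := rfl

/-- The morphism `φ ⊗ ψ : T ⊗ S → T' ⊗ S'`, `[s ⊗ t]_{(A, p)} ↦ [φ(s) ⊗ ψ(t)]_{(A, p)}`
(`mapHom_tmul`). -/
noncomputable def mapHom {T : Tambara.{u, w} G} {S : Tambara.{u, w'} G} {T' : Tambara.{u, w''} G}
    {S' : Tambara.{u, v} G} (φ : Hom T T') (ψ : Hom S S') : Hom (tensor T S) (tensor T' S') :=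
  descHom ((inlHom T' S').comp φ) ((inrHom T' S').comp ψ)

theorem mapHom_tmul {T : Tambara.{u, w} G} {S : Tambara.{u, w'} G} {T' : Tambara.{u, w''} G}
    {S' : Tambara.{u, v} G} (φ : Hom T T') (ψ : Hom S S') {X A : FinGSet G} (p : A →[G] X)
    (s : T.obj A) (t : S.obj A) :
    (mapHom φ ψ).app X (tmul p s t) = tmul p (φ.app A s) (ψ.app A t) := by
  refine (congrArg ((tensor T' S').tr p) (inl_mul_inr (φ.app A s) (ψ.app A t))).trans ?_
  exact (tr_tmul p (idHom A) _ _).trans (congrArg (fun q => tmul q _ _) (homExt fun _ => rfl))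

/-- The multiplication `∇ : T ⊗ T → T`, `[s ⊗ t]_{(A, p)} ↦ p_+(s t)`. -/
noncomputable def nabla (T : Tambara.{u, w} G) : Hom (tensor T T) T :=
  descHom (idMor T) (idMor T)

theorem nabla_tmul {T : Tambara.{u, w} G} {X A : FinGSet G} (p : A →[G] X) (s t : T.obj A) :
    (nabla T).app X (tmul p s t) = T.tr p (s * t) := rfl

/-- The associativity isomorphism `(T ⊗ S) ⊗ U → T ⊗ (S ⊗ U)`. -/
noncomputable def assocHom (T : Tambara.{u, w} G) (S : Tambara.{u, w'} G)
    (U : Tambara.{u, w''} G) : Hom (tensor (tensor T S) U) (tensor T (tensor S U)) :=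
  descHom (descHom (inlHom T (tensor S U)) ((inrHom T (tensor S U)).comp (inlHom S U)))
    ((inrHom T (tensor S U)).comp (inrHom S U))

theorem assocHom_tmul {T : Tambara.{u, w} G} {S : Tambara.{u, w'} G} {U : Tambara.{u, w''} G}
    {X : FinGSet G} (t : T.obj X) (s : S.obj X) (r : U.obj X) :
    (assocHom T S U).app X (tmul (T := tensor T S) (idHom X) (tmul (idHom X) t s) r)
      = tmul (S := tensor S U) (idHom X) t (tmul (idHom X) s r) := by
  let V := tensor T (tensor S U)
  change V.tr (idHom X) (V.tr (idHom X) ((inlHom T (tensor S U)).app X t *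
    (inrHom T (tensor S U)).app X ((inlHom S U).app X s)) *
    (inrHom T (tensor S U)).app X ((inrHom S U).app X r)) = _
  rw [SemiTambara.tr_id, SemiTambara.tr_id, mul_assoc, ← SemiTambara.Hom.map_mul, inl_mul_inr,
    inl_mul_inr]

end Tambara

open Tambara in
/-- A Hopf Tambara functor: a Tambara functor `H` with morphisms `Δ : H → H ⊗ H`, `ε : H → Ω` and
`η : H → H` which satisfy the axioms of a Hopf algebra. The isomorphisms `Ω ⊗ H ≅ H ≅ H ⊗ Ω` are
given by the coprojections of the coproducts `Ω ⊗ H` and `H ⊗ Ω`. -/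
structure HopfTambara (G : Type u) [Group G] extends Tambara.{u, w} G where
  Δ : Tambara.Hom toTambara (tensor toTambara toTambara)
  ε : Tambara.Hom toTambara (burnside G)
  η : Tambara.Hom toTambara toTambara
  coassoc : (assocHom toTambara toTambara toTambara).comp ((mapHom Δ (idMor toTambara)).comp Δ)
    = (mapHom (idMor toTambara) Δ).comp Δ
  counit_left : (mapHom ε (idMor toTambara)).comp Δ = inrHom (burnside G) toTambara
  counit_right : (mapHom (idMor toTambara) ε).comp Δ = inlHom toTambara (burnside G)
  antipode_left : (nabla toTambara).comp ((mapHom η (idMor toTambara)).comp Δ)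
    = (burnsideHom toTambara).comp ε
  antipode_right : (nabla toTambara).comp ((mapHom (idMor toTambara) η).comp Δ)
    = (burnsideHom toTambara).comp ε

open Tambara in
/-- The set of group-like elements of `H(X)`. -/
def HopfTambara.groupLike (H : HopfTambara.{u, w} G) (X : FinGSet G) : Set (H.obj X) :=
  {m | H.Δ.app X m = tmul (idHom X) m m ∧ H.ε.app X m = 1}

/-- The subsets `N(X) ⊆ M(X)` form a Mackey subfunctor of the semi-Mackey functor `M`: they are
stable under restrictions and transfers, and with the restricted structure morphisms they form a
semi-Mackey functor which is a Mackey functor. -/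
structure SemiMackey.IsMackeySubfunctor (M : SemiMackey.{u, w} G)
    (N : ∀ X : FinGSet G, Set (M.obj X)) : Prop where
  res_mem : ∀ {X Y : FinGSet G} (f : X →[G] Y) (a : M.obj Y), a ∈ N Y → M.res f a ∈ N X
  tr_mem : ∀ {X Y : FinGSet G} (f : X →[G] Y) (a : M.obj X), a ∈ N X → M.tr f a ∈ N Y
  isSemiMackey : IsSemiMackey (fun X => N X) (fun f a => ⟨M.res f a, res_mem f a a.2⟩)
    (fun f a => ⟨M.tr f a, tr_mem f a a.2⟩)
  isMackey : SemiMackey.IsMackey ⟨fun X => N X, fun f a => ⟨M.res f a, res_mem f a a.2⟩,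
    fun f a => ⟨M.tr f a, tr_mem f a a.2⟩, isSemiMackey⟩

end

/-! The two conditions defining a group-like element compare maps out of the multiplicative part of
`H`. One side is the pair `(Δ, ε)`. The other sends `m` to the pure tensor `[m ⊗ m]` in the identity
component, together with the constant `1`. If both sides respect restrictions and multiplicative
transfers, then the group-like elements are the equalizer of two morphisms of semi-Mackey functors,
and such an equalizer is again a semi-Mackey functor. For `(Δ, ε)` this is part of being a morphism
of Tambara functors, and for the constant `1` it holds because restrictions and multiplicative
transfers preserve units.

What remains is that `(s, t) ↦ [s ⊗ t]_{(X, id)}` is multiplicatively natural. This is the content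
of `res_tmul_id` and `nm_tmul_id`. Its compatibility with coproducts, products and units is recorded
in `pair_tmul_id`, `tmul_mul_tmul` and `tmul_one_one`. The restriction to multiplicative transfers
matters: by `tr_tmul` an additive transfer along `f` moves a pure tensor from the component `id` to
the component `f`, whereas by `isExp_idSection` a multiplicative transfer keeps it over the
identity.

Inverses come from the antipode. Evaluating the antipode axiom at a group-like `m`, where `Δ(m) = [m
⊗ m]` and `ε(m) = 1`, gives `m · η(m) = 1` (`mul_antipode`). That `η(m)` is again group-like needs
no compatibility between `η` and `Δ`: any inverse of a group-like element is group-like, by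
uniqueness of inverses in the tensor product (`mem_groupLike_of_mul_eq_one`).

A last point is that a semi-Mackey functor carries a monoid structure built from its own coproduct
decomposition and transfers. For group-like elements it has to be identified with the multiplication
inherited from `H` before the inverses just found make the subfunctor Mackey. -/

section

variable {G : Type u} [Group G]

open FinGSet

/-! ### Multiplicative naturality of pure tensors over the identity. -/

namespace Tambara

/-- A pure tensor over the identity is the product of the images of its factors under the two
coprojections. The coprojections are multiplicative and the target is commutative, so the four
factors can be regrouped. This avoids computing a multiplicative transfer along the folding map a
second time, since that is already done in `inl_mul_inr`. -/
theorem tmul_mul_tmul {T : Tambara.{u, w} G} {S : Tambara.{u, w'} G} {X : FinGSet G}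
    (s s' : T.obj X) (t t' : S.obj X) :
    (tmul (idHom X) s t : (tensor T S).obj X) * tmul (idHom X) s' t'
      = tmul (idHom X) (s * s') (t * t') := by
  rw [← inl_mul_inr, ← inl_mul_inr, ← inl_mul_inr, SemiTambara.Hom.map_mul,
    SemiTambara.Hom.map_mul]
  -- All three tensors are now split, and the two sides differ only by exchanging the middle
  -- factors.
  exact mul_mul_mul_comm (G := (tensor T S).obj X) _ _ _ _

/-- By definition the left coprojection sends `1` to `[1 ⊗ 1]`, and a morphism preserves units. -/
theorem tmul_one_one (T : Tambara.{u, w} G) (S : Tambara.{u, w'} G) (X : FinGSet G) :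
    (tmul (idHom X) 1 1 : (tensor T S).obj X) = 1 :=
  (inlHom T S).map_one

theorem res_tmul_id {T : Tambara.{u, w} G} {S : Tambara.{u, w'} G} {X Y : FinGSet G}
    (f : X →[G] Y) (s : T.obj Y) (t : S.obj Y) :
    (tensor T S).res f (tmul (idHom Y) s t) = tmul (idHom X) (T.res f s) (S.res f t) := by
  -- The pull-back of an identity is an identity, so the restricted symbol stays in the identity
  -- component and only its two entries change.
  have h : IsPB f (idHom X) (idHom Y) f :=
    .mk' (fun _ => rfl) (fun _ x e => ⟨x, e.symm, rfl⟩) (fun _ _ _ h => h)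
  exact res_tmul h s t

/-- The identity of `X` has exactly one section over each fibre of `f`, so the dependent product
`Π_f` of `id : X → X` is `Y` itself. The exponential diagram is then trivial, its evaluation map is
the identity, and the norm of a pure tensor is computed entrywise. -/
theorem nm_tmul_id {T : Tambara.{u, w} G} {S : Tambara.{u, w'} G} {X Y : FinGSet G}
    (f : X →[G] Y) (s : T.obj X) (t : S.obj X) :
    (tensor T S).nm f (tmul (idHom X) s t) = tmul (idHom Y) (T.nm f s) (S.nm f t) := by
  refine (nm_tmul (isExp_idSection f) s t).trans ?_
  rw [SemiTambara.res_id, SemiTambara.res_id]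

/-- This serves the coproduct axiom. `pair_tmul` places the glued tensor over the coproduct of the
two structure maps, and the only addition here is that a coproduct of identities is an identity. -/
theorem pair_tmul_id {T : Tambara.{u, w} G} {S : Tambara.{u, w'} G} {X Y : FinGSet G}
    (s : T.obj X) (t : S.obj X) (m : T.obj Y) (n : S.obj Y) :
    SemiTambara.pair (T := (tensor T S).toSemiTambara) (tmul (idHom X) s t) (tmul (idHom Y) m n)
      = tmul (idHom (sum X Y)) (SemiTambara.pair s m) (SemiTambara.pair t n) := by
  have h : sumMap (idHom X) (idHom Y) = idHom (sum X Y) := homExt (by rintro (x | x) <;> rfl)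
  rw [← h]
  exact pair_tmul (idHom X) s t (idHom Y) m n

end Tambara

/-! ### Closure of group-like elements under the multiplicative operations. -/

namespace HopfTambara

open Tambara

variable {H : HopfTambara.{u, w} G} {X Y : FinGSet G}

theorem one_mem_groupLike : (1 : H.obj X) ∈ H.groupLike X :=
  ⟨H.Δ.map_one.trans (tmul_one_one _ _ X).symm, H.ε.map_one⟩

/-- This and the neighbouring closure statements share one pattern: push the operation through `Δ`
and `ε`, substitute the group-like equations, and use that the same operation acts entrywise on pure
tensors and preserves `1` in the Burnside functor. -/
theorem mul_mem_groupLike {m n : H.obj X} (hm : m ∈ H.groupLike X) (hn : n ∈ H.groupLike X) :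
    m * n ∈ H.groupLike X := by
  refine ⟨?_, ?_⟩
  · rw [H.Δ.map_mul, hm.1, hn.1]
    exact tmul_mul_tmul m n m n
  · rw [H.ε.map_mul, hm.2, hn.2, mul_one]

theorem res_mem_groupLike (f : X →[G] Y) {m : H.obj Y} (hm : m ∈ H.groupLike Y) :
    H.res f m ∈ H.groupLike X := by
  refine ⟨?_, ?_⟩
  · rw [H.Δ.map_res, hm.1]
    exact res_tmul_id f m m
  · rw [H.ε.map_res, hm.2, SemiTambara.res_one]

/-- The transfer of the Mackey structure on group-like elements is the norm, and the essential input
is that the norm of `[m ⊗ m]` remains over the identity, with both entries equal to the norm of `m`.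
-/
theorem nm_mem_groupLike (f : X →[G] Y) {m : H.obj X} (hm : m ∈ H.groupLike X) :
    H.nm f m ∈ H.groupLike Y := by
  refine ⟨?_, ?_⟩
  · rw [H.Δ.map_nm, hm.1]
    exact nm_tmul_id f m m
  · rw [H.ε.map_nm, hm.2, SemiTambara.nm_one]

/-- Group-likeness over a coproduct can be tested on the two summands. This supplies the
surjectivity half of the axiom that coproducts go to products. -/
theorem pair_mem_groupLike {m : H.obj X} {n : H.obj Y} (hm : m ∈ H.groupLike X)
    (hn : n ∈ H.groupLike Y) : SemiTambara.pair m n ∈ H.groupLike (sum X Y) := by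
  refine ⟨?_, ?_⟩
  · rw [H.Δ.map_pair, hm.1, hn.1]
    exact pair_tmul_id m m n n
  · rw [H.ε.map_pair, hm.2, hn.2]
    -- The remaining claim is that the element with components `1` and `1` is the unit. An element
    -- over a coproduct is determined by its two restrictions, and restrictions preserve `1`.
    refine SemiTambara.sum_ext ?_ ?_
    · rw [SemiTambara.res_inl_pair, SemiTambara.res_one]
    · rw [SemiTambara.res_inr_pair, SemiTambara.res_one]

/-! ### Inverses through the antipode. -/

theorem mul_antipode {m : H.obj X} (hm : m ∈ H.groupLike X) : m * H.η.app X m = 1 := by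
  -- The antipode axiom is an equality of morphisms, evaluated here at the single element `m`.
  have h : (nabla H.toTambara).app X
      ((mapHom (idMor H.toTambara) H.η).app X (H.Δ.app X m))
        = (burnsideHom H.toTambara).app X (H.ε.app X m) :=
    congrFun (congrFun (congrArg SemiTambara.Hom.app H.antipode_right) X) m
  -- On `[m ⊗ m]` the left side becomes the additive transfer along the identity of `m · η(m)`,
  -- which is that product itself. The right side is the image of `1` under the map from the
  -- Burnside functor, hence `1`.
  rw [hm.1, hm.2, mapHom_tmul, nabla_tmul, SemiTambara.tr_id, SemiTambara.Hom.map_one] at h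
  exact h

/-- Both `Δ(n)` and `[n ⊗ n]` are inverse to `Δ(m) = [m ⊗ m]` in the tensor product, so they
coincide. Stating this for an arbitrary inverse `n` makes it unnecessary to know how `Δ` interacts
with `η`. -/
theorem mem_groupLike_of_mul_eq_one {m n : H.obj X} (hm : m ∈ H.groupLike X) (h : m * n = 1) :
    n ∈ H.groupLike X := by
  refine ⟨?_, ?_⟩
  -- The factors are put in this order so that `Δ(n)` is a left inverse and `[n ⊗ n]` a right
  -- inverse of the same element, as the uniqueness lemma requires.
  · have h₁ : H.Δ.app X n * H.Δ.app X m = 1 := by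
      rw [← H.Δ.map_mul, mul_comm, h, H.Δ.map_one]
    have h₂ : (tmul (idHom X) m m : (tensor H.toTambara H.toTambara).obj X) *
        tmul (idHom X) n n = 1 := by
      rw [tmul_mul_tmul, h, tmul_one_one]
    rw [hm.1] at h₁
    exact left_inv_eq_right_inv h₁ h₂
  -- For the counit, `1 = ε(m) ε(n)` and the factor `ε(m)` is already `1`.
  · have h₁ := H.ε.map_mul m n
    rw [h, H.ε.map_one, hm.2, one_mul] at h₁
    exact h₁.symm

theorem antipode_mem_groupLike {m : H.obj X} (hm : m ∈ H.groupLike X) :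
    H.η.app X m ∈ H.groupLike X :=
  mem_groupLike_of_mul_eq_one hm (mul_antipode hm)

/-! ### The Mackey functor of group-like elements. -/

/-- Functoriality, the Mackey condition and all uniqueness assertions are equations, so they descend
from the multiplicative part of `H` to subsets. Only two axioms assert existence: gluing over a
coproduct, where the glued element must be group-like, and the presence of an element over the empty
set. -/
theorem isSemiMackey_groupLike (H : HopfTambara.{u, w} G) :
    IsSemiMackey (fun X => H.groupLike X)
      (fun f a => ⟨H.res f a, res_mem_groupLike f a.2⟩)
      (fun f a => ⟨H.nm f a, nm_mem_groupLike f a.2⟩) where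
  res_id a := Subtype.ext (H.isSemiMackey_nm.res_id a.1)
  res_comp f g a := Subtype.ext (H.isSemiMackey_nm.res_comp f g a.1)
  tr_id a := Subtype.ext (H.isSemiMackey_nm.tr_id a.1)
  tr_comp f g a := Subtype.ext (H.isSemiMackey_nm.tr_comp f g a.1)
  bijective_sum X Y := by
    refine ⟨fun a b h => ?_, fun c => ?_⟩
    · exact Subtype.ext (SemiTambara.sum_ext
        (congrArg Subtype.val (congrArg Prod.fst h)) (congrArg Subtype.val (congrArg Prod.snd h)))
    · exact ⟨⟨SemiTambara.pair c.1.1 c.2.1, pair_mem_groupLike c.1.2 c.2.2⟩,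
        Prod.ext (Subtype.ext (SemiTambara.res_inl_pair _ _))
          (Subtype.ext (SemiTambara.res_inr_pair _ _))⟩
  existsUnique_empty X h :=
    -- The value over an empty `G`-set is a single point in `H`. The unit shows that this point is
    -- group-like.
    ⟨⟨1, one_mem_groupLike⟩, trivial, fun _ _ =>
      Subtype.ext (SemiMackey.empty_ext (M := H.multiplicativePart) h _ _)⟩
  mackey f' x y f h c := Subtype.ext (H.isSemiMackey_nm.mackey f' x y f h c.1)

/-- The semi-Mackey functor of group-like elements. -/
def groupLikeMackey (H : HopfTambara.{u, w} G) : SemiMackey.{u, w} G :=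
  ⟨fun X => H.groupLike X, fun f a => ⟨H.res f a, res_mem_groupLike f a.2⟩,
    fun f a => ⟨H.nm f a, nm_mem_groupLike f a.2⟩, isSemiMackey_groupLike H⟩

/-- The glued element in the subfunctor is chosen from its own bijectivity axiom, so its agreement
with the one glued in `H` has to be proved. Both have the same restrictions to the summands, and
this determines them. -/
theorem groupLikeMackey_pair (a : H.groupLikeMackey.obj X) (b : H.groupLikeMackey.obj Y) :
    (SemiMackey.pair a b).1 = SemiTambara.pair a.1 b.1 :=
  SemiTambara.sum_ext
    ((congrArg Subtype.val (SemiMackey.res_inl_pair a b)).trans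
      (SemiTambara.res_inl_pair _ _).symm)
    ((congrArg Subtype.val (SemiMackey.res_inr_pair a b)).trans
      (SemiTambara.res_inr_pair _ _).symm)

/-- On either side the product is the norm along the folding map of a glued element. The norm of the
subfunctor is that of `H` by construction, so comparing the glued elements is enough. -/
theorem groupLikeMackey_mul (a b : H.groupLikeMackey.obj X) : (a * b).1 = a.1 * b.1 :=
  congrArg (H.nm (fold X)) (groupLikeMackey_pair a b)

/-- The unit of the subfunctor is the norm, along the map from the empty set, of some chosen
element. In `H` every norm out of an empty `G`-set equals `1`, whatever the choice was. -/
theorem groupLikeMackey_one : (1 : H.groupLikeMackey.obj X).1 = 1 :=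
  SemiTambara.one_eq (T := H.toSemiTambara) (elim (FinGSet.empty G) X) _

theorem isMackey_groupLikeMackey (H : HopfTambara.{u, w} G) : H.groupLikeMackey.IsMackey :=
  -- The antipode supplies the inverse. The equation is checked in `H`, after the product and the
  -- unit of the subfunctor have been translated into those of `H`.
  fun X a => ⟨⟨H.η.app X a.1, antipode_mem_groupLike a.2⟩, Subtype.ext <|
    (groupLikeMackey_mul _ _).trans ((mul_antipode a.2).trans groupLikeMackey_one.symm)⟩

end HopfTambara

end

theorem mainTheorem6 {G : Type u} [Group G] [Finite G] (H : HopfTambara.{u, w} G) :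
    (∀ X : FinGSet G, ∃ S : Submonoid (H.multiplicativePart.obj X),
      (S : Set (H.multiplicativePart.obj X)) = H.groupLike X ∧ ∀ m ∈ S, ∃ n ∈ S, m * n = 1) ∧
    H.multiplicativePart.IsMackeySubfunctor (fun X => H.groupLike X) := by
  refine ⟨fun X => ⟨⟨⟨H.groupLike X, HopfTambara.mul_mem_groupLike⟩,
    HopfTambara.one_mem_groupLike⟩, rfl, fun m hm => ⟨H.η.app X m,
      HopfTambara.antipode_mem_groupLike hm, HopfTambara.mul_antipode hm⟩⟩, ?_⟩
  -- The record asks for a semi-Mackey structure on the family of subtypes with the restricted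
  -- operations. These are the data of `groupLikeMackey`, up to proofs of membership, so its two
  -- structural theorems apply directly.
  exact
    { res_mem := fun f _ ha => HopfTambara.res_mem_groupLike f ha
      tr_mem := fun f _ ha => HopfTambara.nm_mem_groupLike f ha
      isSemiMackey := H.isSemiMackey_groupLike
      isMackey := H.isMackey_groupLikeMackey }
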